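/- **Setting.** Let $\mathcal T=(V,E,F)$ be an infinite, locally finite (simplicial) triangulation of the open disk, with vertex, edge and face sets $V,E,F$, and let $\Phi:E\to[0,\frac{\pi}{2}]$ be an intersection angle. A (hyperbolic) discrete conformal factor is a function $u\in(-\infty,0)^V$; it corresponds to the radii $r\in(0,\infty)^V$ with $u_i=\ln\tanh\frac{r_i}{2}$. It gives the edge $\{i,j\}\in E$ the length $$l_{ij}=\cosh^{-1}\bigl(\cosh r_i\cosh r_j+\cos\Phi_{ij}\,\sinh r_i\sinh r_j\bigr),$$ and each face $\{i,j,k\}\in F$ the inner angles of the hyperbolic triangle with side lengths $l_{ij},l_{jk},l_{ik}$; let $\theta_i^{jk}$ be the angle at $i$. The discrete Gaussian curvature is $$K_i(u)=2\pi-\sum_{\{i,j,k\}\in F}\theta_i^{jk},\qquad i\in V.$$ **Theorem 4.2.** Let $\hat K\in(-\infty,2\pi)^V$, and let $u(0)\in(-\infty,0)^V$ be a discrete conformal factor with $K_i(u(0))\le\hat K_i$ for every $i\in V$. Then there is a solution $u(t)\in(-\infty,0)^V$, $t\in[0,\infty)$, of the flow $$\frac{du_i}{dt}=-(K_i(u)-\hat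 K_i),\qquad i\in V,$$ with initial value $u(0)$, which converges as $t\to\infty$, at every vertex, to a discrete conformal factor $u^*\in(-\infty,0)^V$ with $K_i(u^*)=\hat K_i$ for every $i\in V$. Moreover, if $K(u(0))$ is bounded on $V$, then among the solutions on $[0,\infty)$ with initial value $u(0)$ there is exactly one whose curvature $K_i(u(t))$ is bounded on $V\times[0,\infty)$; for this solution $u_i(t)$ and $K_i(u(t))$ are $C^\infty$ in $t\in[0,\infty)$ for every $i\in V$. -/

import Mathlib

noncomputable section

namespace CirclePacking

variable {V : Type*}

/-! ### Disk triangulations -/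

/-- The edges of a simplicial complex, as unordered pairs of distinct vertices. -/
def edges (T : AbstractSimplicialComplex V) : Set (Sym2 V) :=
  {e | ∃ i j : V, i ≠ j ∧ e = s(i, j) ∧ ∃ σ ∈ T, (σ : Set V) = {i, j}}

/-- `i`, `j`, `k` are the three (distinct) vertices of a triangle of `T`. -/
def IsFace (T : AbstractSimplicialComplex V) (i j k : V) : Prop :=
  i ≠ j ∧ i ≠ k ∧ j ≠ k ∧ ∃ σ ∈ T, (σ : Set V) = {i, j, k}

/-- The geometric realization of a simplicial complex, through barycentric coordinates: the points
of a simplex `σ` are the families of nonnegative weights supported in `σ` with sum `1`. It carries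
the topology induced from the product `V → ℝ`; for a locally finite complex this is the usual (weak)
topology, because the open star of every simplex lies in a finite subcomplex. -/
def realization (T : AbstractSimplicialComplex V) : Set (V → ℝ) :=
  {x | (∀ v, 0 ≤ x v) ∧ ∃ σ ∈ T, (∀ v, v ∉ σ → x v = 0) ∧ ∑ v ∈ σ, x v = 1}

/-- `T` is an infinite, locally finite triangulation of the open disk. -/
structure IsInfiniteDiskTriangulation (T : AbstractSimplicialComplex V) : Prop where
  /-- there are infinitely many vertices -/
  infinite : Infinite V
  /-- every vertex lies in finitely many simplices only -/
  locallyFinite : ∀ v : V, {σ : Finset V | σ ∈ T ∧ v ∈ σ}.Finite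
  /-- all simplices are vertices, edges or triangles -/
  card_le : ∀ σ ∈ T, σ.card ≤ 3
  /-- the underlying space is an open disk -/
  disk : Nonempty (realization T ≃ₜ Metric.ball (0 : EuclideanSpace ℝ (Fin 2)) 1)

/-! ### Hyperbolic circle-packing metrics and their curvature -/

/-- The hyperbolic radius `r` belonging to a conformal factor `u = ln (tanh (r / 2)) < 0`. -/
def radius (u : ℝ) : ℝ := 2 * Real.artanh (Real.exp u)

theorem log_tanh_radius {u : ℝ} (hu : u < 0) : Real.log (Real.tanh (radius u / 2)) = u := by
  have h1 : Real.exp u < 1 := by simpa using Real.exp_lt_exp.2 hu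
  have h0 : 0 < Real.exp u := Real.exp_pos u
  rw [radius, mul_div_cancel_left₀ _ (two_ne_zero), Real.tanh_artanh ⟨by linarith, h1⟩,
    Real.log_exp]

theorem radius_log_tanh (r : ℝ) (hr : 0 < r) : radius (Real.log (Real.tanh (r / 2))) = r := by
  have h0 : 0 < Real.tanh (r / 2) := by
    rw [Real.tanh_eq_sinh_div_cosh]
    exact div_pos (Real.sinh_pos_iff.2 (by linarith)) (Real.cosh_pos _)
  rw [radius, Real.exp_log h0, Real.artanh_tanh]
  ring

/-- The hyperbolic length of the edge `{i, j}`, for radii `r` and intersection angles `Φ`. -/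
def edgeLength (Φ : Sym2 V → ℝ) (r : V → ℝ) (i j : V) : ℝ :=
  Real.arcosh (Real.cosh (r i) * Real.cosh (r j)
    + Real.cos (Φ s(i, j)) * Real.sinh (r i) * Real.sinh (r j))

theorem edgeLength_comm (Φ : Sym2 V → ℝ) (r : V → ℝ) (i j : V) :
    edgeLength Φ r i j = edgeLength Φ r j i := by
  unfold edgeLength
  rw [Sym2.eq_swap]
  congr 1
  ring

/-- The angle, opposite to the side of length `a`, of the hyperbolic triangle with side lengths
`a`, `b`, `c` (hyperbolic law of cosines). -/
def hyperbolicAngle (a b c : ℝ) : ℝ :=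
  Real.arccos ((Real.cosh b * Real.cosh c - Real.cosh a) / (Real.sinh b * Real.sinh c))

/-- The inner angle at the vertex `i` of the triangle with vertices `i`, `j`, `k`. -/
def innerAngle (Φ : Sym2 V → ℝ) (r : V → ℝ) (i j k : V) : ℝ :=
  hyperbolicAngle (edgeLength Φ r j k) (edgeLength Φ r i j) (edgeLength Φ r i k)

theorem innerAngle_comm (Φ : Sym2 V → ℝ) (r : V → ℝ) (i j k : V) :
    innerAngle Φ r i j k = innerAngle Φ r i k j := by
  unfold innerAngle hyperbolicAngle
  rw [edgeLength_comm Φ r j k, mul_comm (Real.cosh _) (Real.cosh _),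
    mul_comm (Real.sinh _) (Real.sinh _)]

/-- The inner angle at `i`, as a function of the side `{j, k}` opposite to `i`. -/
def innerAngleOpp (Φ : Sym2 V → ℝ) (r : V → ℝ) (i : V) : Sym2 V → ℝ :=
  Sym2.lift ⟨fun j k => innerAngle Φ r i j k, fun j k => innerAngle_comm Φ r i j k⟩

/-- The sides opposite to `i` of the triangles of `T` that have `i` as a vertex; each such triangle
gives exactly one. -/
def oppositeSides (T : AbstractSimplicialComplex V) (i : V) : Set (Sym2 V) :=
  {e | ∃ j k : V, e = s(j, k) ∧ IsFace T i j k}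

/-- In a locally finite complex the sum in `curvature` below is a finite one. -/
theorem oppositeSides_finite (T : AbstractSimplicialComplex V) (i : V)
    (h : {σ : Finset V | σ ∈ T ∧ i ∈ σ}.Finite) : (oppositeSides T i).Finite := by
  have hfin : (⋃ σ ∈ {σ : Finset V | σ ∈ T ∧ i ∈ σ}, ((σ : Set V) ×ˢ (σ : Set V))).Finite :=
    h.biUnion fun σ _ => (σ.finite_toSet).prod (σ.finite_toSet)
  refine (hfin.image fun p : V × V => s(p.1, p.2)).subset ?_
  rintro e ⟨j, k, rfl, -, -, -, σ, hσ, hs⟩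
  have hi : i ∈ (σ : Set V) := by rw [hs]; simp
  have hj : j ∈ (σ : Set V) := by rw [hs]; simp
  have hk : k ∈ (σ : Set V) := by rw [hs]; simp
  refine ⟨(j, k), ?_, rfl⟩
  simp only [Set.mem_iUnion]
  exact ⟨σ, ⟨hσ, by exact_mod_cast hi⟩, hj, hk⟩

/-- The discrete Gaussian curvature at `i` of the hyperbolic circle-packing metric with radii `r`:
`2π` minus the sum of the inner angles at `i`, over the triangles of `T` that contain `i`. -/
def curvature (T : AbstractSimplicialComplex V) (Φ : Sym2 V → ℝ) (r : V → ℝ) (i : V) : ℝ :=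
  2 * Real.pi - ∑ᶠ e ∈ oppositeSides T i, innerAngleOpp Φ r i e

/-- `K_i(u)`: the curvature at `i` of the metric with discrete conformal factor `u`. -/
def K (T : AbstractSimplicialComplex V) (Φ : Sym2 V → ℝ) (u : V → ℝ) (i : V) : ℝ :=
  curvature T Φ (fun j => radius (u j)) i

/-- Discrete conformal factors in hyperbolic background geometry. -/
def IsConformalFactor (u : V → ℝ) : Prop := ∀ i, u i < 0

/-! ### The flow with prescribed curvature -/

/-- `u(t)`, `t ∈ [0, ∞)`, is a family of hyperbolic conformal factors which solves
`du_i/dt = -(K_i(u) - K̂_i)` for all vertices `i` and all `t ≥ 0` (with the one-sided derivative at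
`t = 0`). The values of `u` at negative times play no role. -/
structure IsFlowSolution (T : AbstractSimplicialComplex V) (Φ : Sym2 V → ℝ) (Khat : V → ℝ)
    (u : ℝ → V → ℝ) : Prop where
  conformal : ∀ t, 0 ≤ t → IsConformalFactor (u t)
  flow : ∀ t, 0 ≤ t → ∀ i,
    HasDerivWithinAt (fun s => u s i) (-(K T Φ (u t) i - Khat i)) (Set.Ici 0) t

/-- The curvature is bounded on `V × [0, ∞)`. -/
def HasBoundedCurvature (T : AbstractSimplicialComplex V) (Φ : Sym2 V → ℝ)
    (u : ℝ → V → ℝ) : Prop :=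
  ∃ C : ℝ, ∀ t, 0 ≤ t → ∀ i, |K T Φ (u t) i| ≤ C

/-- Smoothness in time on `[0, ∞)`, at every vertex. -/
def IsSmoothInTime (f : ℝ → V → ℝ) : Prop :=
  ∀ i, ContDiffOn ℝ (⊤ : ℕ∞) (fun t => f t i) (Set.Ici 0)

end CirclePacking

end

/-!
In terms of the conformal factors, the inner angles are smooth on `(-∞, 0)³`, and an angle `θ` at
`i` increases with the factors at the other two vertices, while `-12 ≤ ∂θ/∂uᵢ ≤ 0` outweighs these
two derivatives together. Hence the velocity `K̂ - K` is cooperative up to a multiple of `uᵢ`, with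
`u₀` as a subsolution; factors so close to `0` that the angles are small form a supersolution.
Between the two, the Picard operator of the flow is monotone on the nondecreasing curves. Its least
fixed point is a solution which converges, being nondecreasing and bounded, and its limit is a zero
of the velocity. Induction on the least fixed point shows that the supremum of the velocity does not
exceed its value at time `0`, so the curvature stays bounded.

For the uniqueness, each angle bounds its own derivatives, hence `log θ` is Lipschitz. Two factors
at bounded distance `m` therefore have curvatures at distance `O(m)`, uniformly over the vertices,
when the curvatures are bounded, and this calls for Gronwall's argument in the supremum norm. As the
supremum over infinitely many vertices need not be attained, the argument is run at each vertex
against an exponential barrier, which is then halved repeatedly.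
-/

noncomputable section

namespace CirclePacking

open Real Set Filter Topology

section Polynomials

variable {α β γ X Y Z : ℝ}

/-- For circles `1`, `2` with `X = cosh u₁`, `Y = cosh u₂` which meet at an angle with cosine `γ`:
the square of `sinh ℓ₁₂ * sinh u₁ * sinh u₂`, where `ℓ₁₂` is the distance of the centers. -/
def sideForm (γ X Y : ℝ) : ℝ := X ^ 2 + Y ^ 2 + 2 * γ * X * Y + γ ^ 2 - 1

/-- The numerator of the cosine of the angle at the center of circle `1`, over the denominator
`√(sideForm γ X Y) * √(sideForm β X Z)`. The cosines `α`, `β`, `γ` belong to the sides opposite to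
`1`, `2`, `3`. -/
def cosNum (α β γ X Y Z : ℝ) : ℝ := Y * Z + β * X * Y + γ * X * Z + β * γ + α * (1 - X ^ 2)

/-- The linear form in `X`, `Y`, `Z` whose coefficients are the cofactors of the Gram matrix of the
three circles that belong to circle `3`. -/
def cofactorForm (α β γ X Y Z : ℝ) : ℝ :=
  (β + α * γ) * X + (α + β * γ) * Y + (1 - γ ^ 2) * Z

/-- The quadratic part of `gramForm`. -/
def gramQuadratic (α β γ X Y Z : ℝ) : ℝ :=
  (1 - α ^ 2) * X ^ 2 + (1 - β ^ 2) * Y ^ 2 + (1 - γ ^ 2) * Z ^ 2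
    + 2 * (γ + α * β) * X * Y + 2 * (β + α * γ) * X * Z + 2 * (α + β * γ) * Y * Z

/-- The Gram determinant of the three centers, up to the factor `(sinh u₁ * sinh u₂ * sinh u₃) ^ 2`:
it is positive if and only if the centers span a nondegenerate hyperbolic triangle. -/
def gramForm (α β γ X Y Z : ℝ) : ℝ :=
  gramQuadratic α β γ X Y Z + (α ^ 2 + β ^ 2 + γ ^ 2 + 2 * α * β * γ - 1)

theorem sideForm_comm (γ X Y : ℝ) : sideForm γ X Y = sideForm γ Y X := by
  unfold sideForm; ring

theorem cosNum_swap (α β γ X Y Z : ℝ) : cosNum α γ β X Z Y = cosNum α β γ X Y Z := by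
  unfold cosNum; ring

theorem gramForm_swap (α β γ X Y Z : ℝ) : gramForm α γ β X Z Y = gramForm α β γ X Y Z := by
  unfold gramForm gramQuadratic; ring

theorem sideForm_eq (γ X Y : ℝ) :
    sideForm γ X Y = (X * Y + γ) ^ 2 - (X ^ 2 - 1) * (Y ^ 2 - 1) := by
  unfold sideForm; ring

theorem cosNum_eq (α β γ X Y Z : ℝ) :
    cosNum α β γ X Y Z = (X * Z + β) * (X * Y + γ) - (X ^ 2 - 1) * (Y * Z + α) := by
  unfold cosNum; ring

theorem sideForm_mul_sideForm_sub_cosNum_sq (α β γ X Y Z : ℝ) :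
    sideForm γ X Y * sideForm β X Z - cosNum α β γ X Y Z ^ 2
      = (X ^ 2 - 1) * gramForm α β γ X Y Z := by
  unfold sideForm cosNum gramForm gramQuadratic; ring

theorem sideForm_mul_sub_cosNum_mul (α β γ X Y Z : ℝ) :
    (Z + β * X) * sideForm γ X Y - cosNum α β γ X Y Z * (Y + γ * X)
      = (X ^ 2 - 1) * cofactorForm α β γ X Y Z := by
  unfold sideForm cosNum cofactorForm; ring

theorem cosNum_mul_sub_sideForm_mul (α β γ X Y Z : ℝ) :
    cosNum α β γ X Y Z * ((X + γ * Y) * sideForm β X Z + (X + β * Z) * sideForm γ X Y)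
        - (β * Y + γ * Z - 2 * α * X) * (sideForm γ X Y * sideForm β X Z)
      = (X * Y + γ) * cofactorForm α β γ X Y Z * sideForm β X Z
        + (X * Z + β) * cofactorForm α γ β X Z Y * sideForm γ X Y := by
  unfold sideForm cosNum cofactorForm; ring

end Polynomials

section Bounds

variable {α β γ X Y Z : ℝ}

theorem mul_le_sideForm (hγ : 0 ≤ γ) (hX : 1 ≤ X) (hY : 1 ≤ Y) : X * Y ≤ sideForm γ X Y := by
  unfold sideForm
  nlinarith [sq_nonneg (X - Y), mul_nonneg (mul_nonneg hγ (by linarith : 0 ≤ X))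
    (by linarith : 0 ≤ Y), mul_le_mul hX hY zero_le_one (by linarith), sq_nonneg γ]

theorem sq_le_sideForm (hγ : 0 ≤ γ) (hX : 0 ≤ X) (hY : 1 ≤ Y) : X ^ 2 ≤ sideForm γ X Y := by
  have hγXY : 0 ≤ γ * X * Y := by positivity
  unfold sideForm
  nlinarith

theorem sideForm_pos (hγ : 0 ≤ γ) (hX : 1 ≤ X) (hY : 1 ≤ Y) : 0 < sideForm γ X Y := by
  nlinarith [mul_le_sideForm hγ hX hY]

theorem sqrt_sideForm_le_add (hγ : γ ∈ Icc (0 : ℝ) 1) (hX : 0 ≤ X) (hY : 0 ≤ Y) :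
    √(sideForm γ X Y) ≤ X + Y := by
  refine sqrt_le_iff.2 ⟨by positivity, ?_⟩
  unfold sideForm
  nlinarith [mul_nonneg (mul_nonneg hX hY) (sub_nonneg.2 hγ.2), hγ.1, hγ.2]

theorem sqrt_sideForm_le_mul_add (hγ : 0 ≤ γ) (hX : 1 ≤ X) (hY : 1 ≤ Y) :
    √(sideForm γ X Y) ≤ X * Y + γ := by
  refine sqrt_le_iff.2 ⟨by positivity, ?_⟩
  rw [sideForm_eq]
  exact sub_le_self _ (mul_nonneg (by nlinarith) (by nlinarith))

theorem cofactorForm_nonneg (hα : 0 ≤ α) (hβ : 0 ≤ β) (hγ : γ ∈ Icc (0 : ℝ) 1)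
    (hX : 0 ≤ X) (hY : 0 ≤ Y) (hZ : 0 ≤ Z) : 0 ≤ cofactorForm α β γ X Y Z := by
  have hγ0 := hγ.1
  have hγ2 : 0 ≤ 1 - γ ^ 2 := by nlinarith [hγ.2]
  unfold cofactorForm
  positivity

theorem three_le_gramQuadratic (hα : α ∈ Icc (0 : ℝ) 1) (hβ : β ∈ Icc (0 : ℝ) 1)
    (hγ : γ ∈ Icc (0 : ℝ) 1) (hX : 1 ≤ X) (hY : 1 ≤ Y) (hZ : 1 ≤ Z) :
    3 ≤ gramQuadratic α β γ X Y Z := by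
  have square {a x : ℝ} (ha : a ∈ Icc (0 : ℝ) 1) (hx : 1 ≤ x) : 1 - a ≤ (1 - a ^ 2) * x ^ 2 := by
    nlinarith [ha.1, ha.2, mul_nonneg (by nlinarith [ha.1, ha.2] : 0 ≤ 1 - a ^ 2)
      (by nlinarith : 0 ≤ x ^ 2 - 1)]
  have product {a b c x y : ℝ} (ha : 0 ≤ a) (hb : 0 ≤ b) (hc : 0 ≤ c) (hx : 1 ≤ x) (hy : 1 ≤ y) :
      c ≤ (c + a * b) * x * y := by
    nlinarith [mul_le_mul hx hy zero_le_one (by linarith), mul_nonneg ha hb,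
      mul_nonneg (add_nonneg hc (mul_nonneg ha hb)) (by nlinarith : 0 ≤ x * y - 1)]
  unfold gramQuadratic
  linarith [square hα hX, square hβ hY, square hγ hZ, product hα.1 hβ.1 hγ.1 hX hY,
    product hα.1 hγ.1 hβ.1 hX hZ, product hβ.1 hγ.1 hα.1 hY hZ, hα.1, hβ.1, hγ.1]

theorem gramQuadratic_le (hα : α ∈ Icc (0 : ℝ) 1) (hβ : β ∈ Icc (0 : ℝ) 1)
    (hγ : γ ∈ Icc (0 : ℝ) 1) (hX : 1 ≤ X) (hY : 1 ≤ Y) (hZ : 1 ≤ Z) :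
    gramQuadratic α β γ X Y Z ≤ 3 / 2 * gramForm α β γ X Y Z := by
  have hαβγ := mul_nonneg (mul_nonneg hα.1 hβ.1) hγ.1
  unfold gramForm
  nlinarith [three_le_gramQuadratic hα hβ hγ hX hY hZ]

theorem gramForm_pos (hα : α ∈ Icc (0 : ℝ) 1) (hβ : β ∈ Icc (0 : ℝ) 1)
    (hγ : γ ∈ Icc (0 : ℝ) 1) (hX : 1 ≤ X) (hY : 1 ≤ Y) (hZ : 1 ≤ Z) :
    0 < gramForm α β γ X Y Z := by
  linarith [three_le_gramQuadratic hα hβ hγ hX hY hZ, gramQuadratic_le hα hβ hγ hX hY hZ]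

theorem cofactor_mul_le (hα : α ∈ Icc (0 : ℝ) 1) (hβ : β ∈ Icc (0 : ℝ) 1) (hγ : 0 ≤ γ)
    {a b c : ℝ} (ha : 0 ≤ a) (hab : a ≤ b) (hac : a ≤ c) :
    (β + α * γ) * a ≤ (1 - α ^ 2) * b + (γ + α * β) * c := by
  have hcofactor : β + α * γ ≤ (1 - α ^ 2) + (γ + α * β) := by
    nlinarith [mul_nonneg (sub_nonneg.2 hα.2) (by linarith [hα.1, hβ.2] : 0 ≤ 1 + α - β + γ)]
  have hb : 0 ≤ 1 - α ^ 2 := by nlinarith [hα.1, hα.2]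
  have hc : 0 ≤ γ + α * β := add_nonneg hγ (mul_nonneg hα.1 hβ.1)
  nlinarith [mul_le_mul_of_nonneg_right hcofactor ha, mul_le_mul_of_nonneg_left hab hb,
    mul_le_mul_of_nonneg_left hac hc]

theorem one_sub_sq_mul_le (hα : α ∈ Icc (0 : ℝ) 1) (hγ : γ ∈ Icc (0 : ℝ) 1) (hX : 0 ≤ X)
    (hZ : 0 ≤ Z) :
    (1 - γ ^ 2) * (X * Z) ≤ ((1 - α ^ 2) * X ^ 2 + (1 - γ ^ 2) * Z ^ 2) / 2 + α * (X * Z) := by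
  have hα2 : 0 ≤ 1 - α ^ 2 := by nlinarith [hα.1, hα.2]
  have hγ2 : 0 ≤ 1 - γ ^ 2 := by nlinarith [hγ.1, hγ.2]
  have hcofactor : 1 - γ ^ 2 ≤ (1 - α ^ 2) * (1 - γ ^ 2) + α := by
    nlinarith [hα.1, hα.2, mul_nonneg (sq_nonneg α) (sq_nonneg γ)]
  have hamgm : (1 - α ^ 2) * (1 - γ ^ 2) * (X * Z)
      ≤ ((1 - α ^ 2) * X ^ 2 + (1 - γ ^ 2) * Z ^ 2) / 2 := by
    nlinarith [mul_nonneg (mul_nonneg hα2 hγ2) (sq_nonneg (X - Z)),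
      mul_nonneg (mul_nonneg hα2 (sq_nonneg γ)) (sq_nonneg X),
      mul_nonneg (mul_nonneg hγ2 (sq_nonneg α)) (sq_nonneg Z)]
  nlinarith [mul_le_mul_of_nonneg_right hcofactor (mul_nonneg hX hZ)]

theorem sq_cofactor_mul_le (hα : α ∈ Icc (0 : ℝ) 1) (hβ : β ∈ Icc (0 : ℝ) 1)
    (hγ : γ ∈ Icc (0 : ℝ) 1) {m : ℝ} (hm : 0 ≤ m) (hX : m ≤ X) (hY : m ≤ Y) :
    ((β + α * γ) * m) ^ 2 ≤ 2 * ((1 - α ^ 2) * X ^ 2 + (γ + α * β) * (X * Y)) := by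
  have hc : 0 ≤ β + α * γ := add_nonneg hβ.1 (mul_nonneg hα.1 hγ.1)
  have hc2 : β + α * γ ≤ 2 := by nlinarith [hα.1, hα.2, hβ.2, hγ.1, hγ.2]
  calc ((β + α * γ) * m) ^ 2 = (β + α * γ) * ((β + α * γ) * m ^ 2) := by ring
    _ ≤ 2 * ((β + α * γ) * m ^ 2) := by gcongr
    _ ≤ 2 * ((1 - α ^ 2) * X ^ 2 + (γ + α * β) * (X * Y)) := by
        gcongr
        exact cofactor_mul_le hα hβ hγ.1 (sq_nonneg m) (by gcongr)
          (by nlinarith [mul_le_mul hX hY hm (hm.trans hX)])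

theorem cofactorForm_min_le (hα : α ∈ Icc (0 : ℝ) 1) (hβ : β ∈ Icc (0 : ℝ) 1)
    (hγ : γ ∈ Icc (0 : ℝ) 1) (hX : 1 ≤ X) (hY : 1 ≤ Y) (hZ : 1 ≤ Z) :
    cofactorForm α β γ (min X Y) (min X Y) Z ≤ 3 * √(gramForm α β γ X Y Z) := by
  have hm : 0 ≤ min X Y := le_min (by linarith) (by linarith)
  have h₁ := sq_cofactor_mul_le hα hβ hγ hm (min_le_left _ _) (min_le_right _ _)
  have h₂ := sq_cofactor_mul_le hβ hα hγ hm (min_le_right _ _) (min_le_left _ _)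
  have h₃ : ((1 - γ ^ 2) * Z) ^ 2 ≤ (1 - γ ^ 2) * Z ^ 2 := by
    have : 0 ≤ 1 - γ ^ 2 := by nlinarith [hγ.1, hγ.2]
    nlinarith [mul_nonneg (mul_nonneg this (sq_nonneg γ)) (sq_nonneg Z)]
  have hsum : ((β + α * γ) * min X Y) ^ 2 + ((α + β * γ) * min X Y) ^ 2 + ((1 - γ ^ 2) * Z) ^ 2
      ≤ 2 * gramQuadratic α β γ X Y Z := by
    obtain ⟨⟨hα0, -⟩, ⟨hβ0, -⟩, hγ0, hγ1⟩ := And.intro hα (And.intro hβ hγ)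
    have hZ2 : 0 ≤ (1 - γ ^ 2) * Z ^ 2 := mul_nonneg (by nlinarith) (sq_nonneg Z)
    have hXZ : 0 ≤ (β + α * γ) * X * Z := by positivity
    have hYZ : 0 ≤ (α + β * γ) * Y * Z := by positivity
    unfold gramQuadratic
    linarith
  rw [← abs_of_pos (three_pos (α := ℝ)), ← sqrt_sq_eq_abs, ← sqrt_mul (sq_nonneg _)]
  refine le_sqrt_of_sq_le ?_
  set a := (β + α * γ) * min X Y
  set b := (α + β * γ) * min X Y
  set c := (1 - γ ^ 2) * Z
  calc (a + b + c) ^ 2 ≤ 3 * (a ^ 2 + b ^ 2 + c ^ 2) := by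
        nlinarith [sq_nonneg (a - b), sq_nonneg (a - c), sq_nonneg (b - c)]
    _ ≤ 3 ^ 2 * gramForm α β γ X Y Z := by linarith [gramQuadratic_le hα hβ hγ hX hY hZ]

theorem mul_add_mul_cofactorForm_le (hα : α ∈ Icc (0 : ℝ) 1) (hβ : β ∈ Icc (0 : ℝ) 1)
    (hγ : γ ∈ Icc (0 : ℝ) 1) (hX : 1 ≤ X) (hY : 1 ≤ Y) (hZ : 1 ≤ Z) :
    (X * Y + γ) * cofactorForm α β γ X Y Z ≤ 6 * (sideForm γ X Y * √(gramForm α β γ X Y Z)) := by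
  have hE := mul_le_sideForm hγ.1 hX hY
  have hXE : X * Y * X ≤ sideForm γ X Y * min X Y := by
    rcases min_choice X Y with h | h <;> rw [h]
    · gcongr
    · nlinarith [sq_le_sideForm hγ.1 (by linarith : 0 ≤ X) hY]
  have hYE : X * Y * Y ≤ sideForm γ X Y * min X Y := by
    rcases min_choice X Y with h | h <;> rw [h]
    · have := sq_le_sideForm hγ.1 (by linarith : 0 ≤ Y) hX
      rw [sideForm_comm] at this
      nlinarith
    · gcongr
  have hγ2 : 0 ≤ 1 - γ ^ 2 := by nlinarith [hγ.1, hγ.2]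
  have hα0 := hα.1
  have hβ0 := hβ.1
  have hγ0 := hγ.1
  calc (X * Y + γ) * cofactorForm α β γ X Y Z
      ≤ (2 * (X * Y)) * cofactorForm α β γ X Y Z := by
        refine mul_le_mul_of_nonneg_right (by nlinarith [hγ.2])
          (cofactorForm_nonneg hα.1 hβ.1 hγ ?_ ?_ ?_) <;> linarith
    _ = 2 * ((β + α * γ) * (X * Y * X) + (α + β * γ) * (X * Y * Y)
          + (1 - γ ^ 2) * (X * Y * Z)) := by unfold cofactorForm; ring
    _ ≤ 2 * ((β + α * γ) * (sideForm γ X Y * min X Y) + (α + β * γ) * (sideForm γ X Y * min X Y)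
          + (1 - γ ^ 2) * (sideForm γ X Y * Z)) := by gcongr
    _ = 2 * sideForm γ X Y * cofactorForm α β γ (min X Y) (min X Y) Z := by
        unfold cofactorForm; ring
    _ ≤ 2 * sideForm γ X Y * (3 * √(gramForm α β γ X Y Z)) := by
        have := sideForm_pos hγ.1 hX hY
        gcongr
        exact cofactorForm_min_le hα hβ hγ hX hY hZ
    _ = 6 * (sideForm γ X Y * √(gramForm α β γ X Y Z)) := by ring

theorem cofactorForm_mul_add_le (hα : α ∈ Icc (0 : ℝ) 1) (hβ : β ∈ Icc (0 : ℝ) 1)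
    (hγ : γ ∈ Icc (0 : ℝ) 1) (hX : 0 ≤ X) (hY : 0 ≤ Y) (hZ : 0 ≤ Z) {t e : ℝ} (ht : 0 ≤ t)
    (htY : t ≤ Y) (hte : t ≤ e) (hXe : X ≤ e) :
    t * cofactorForm α β γ X Y Z * (X + Z) ≤ 3 / 2 * (gramQuadratic α β γ X Y Z * e) := by
  obtain ⟨⟨hα0, hα1⟩, ⟨hβ0, hβ1⟩, hγ0, hγ1⟩ := And.intro hα (And.intro hβ hγ)
  have he : 0 ≤ e := ht.trans hte
  have hα2 : 0 ≤ 1 - α ^ 2 := by nlinarith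
  have hγ2 : 0 ≤ 1 - γ ^ 2 := by nlinarith
  have htX : t * X ≤ e * Y := mul_comm Y e ▸ mul_le_mul htY hXe hX hY
  have hXX := cofactor_mul_le hα hβ hγ.1 (by positivity : 0 ≤ t * X * X)
    (mul_le_mul_of_nonneg_right (mul_le_mul_of_nonneg_right hte hX) hX)
    (mul_le_mul_of_nonneg_right htX hX)
  have hXY := cofactor_mul_le hβ hα hγ.1 (by positivity : 0 ≤ t * X * Y)
    (mul_le_mul_of_nonneg_right htX hY)
    (mul_le_mul_of_nonneg_right (mul_le_mul_of_nonneg_right hte hX) hY)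
  have hXZ : (1 - γ ^ 2) * (t * X * Z)
      ≤ e * (((1 - α ^ 2) * X ^ 2 + (1 - γ ^ 2) * Z ^ 2) / 2) + α * (e * Y * Z) :=
    calc (1 - γ ^ 2) * (t * X * Z) = t * ((1 - γ ^ 2) * (X * Z)) := by ring
      _ ≤ t * (((1 - α ^ 2) * X ^ 2 + (1 - γ ^ 2) * Z ^ 2) / 2 + α * (X * Z)) := by
          gcongr ?_ * ?_; exact one_sub_sq_mul_le hα hγ hX hZ
      _ = t * (((1 - α ^ 2) * X ^ 2 + (1 - γ ^ 2) * Z ^ 2) / 2) + α * (t * X * Z) := by ring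
      _ ≤ _ := by gcongr
  have hZ' : t * cofactorForm α β γ X Y Z * Z ≤ e * cofactorForm α β γ X Y Z * Z := by
    have := cofactorForm_nonneg hα.1 hβ.1 hγ hX hY hZ
    gcongr
  have hYY : 0 ≤ (1 - β ^ 2) * (e * Y * Y) := mul_nonneg (by nlinarith) (by positivity)
  have hcross : 0 ≤ (γ + α * β) * (e * X * Y) + 2 * (β + α * γ) * (e * X * Z)
      + (α + 2 * β * γ) * (e * Y * Z) := by positivity
  unfold cofactorForm gramQuadratic at *
  linarith

theorem cofactorForm_mul_sqrt_le (hα : α ∈ Icc (0 : ℝ) 1) (hβ : β ∈ Icc (0 : ℝ) 1)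
    (hγ : γ ∈ Icc (0 : ℝ) 1) (hX : 1 ≤ X) (hY : 1 ≤ Y) (hZ : 1 ≤ Z) {t : ℝ} (ht : 0 ≤ t)
    (htY : t ≤ Y) :
    t * cofactorForm α β γ X Y Z * √(sideForm β X Z)
      ≤ 3 * (gramForm α β γ X Y Z * √(sideForm γ X Y)) := by
  have hX0 : 0 ≤ X := by linarith
  have hY0 : 0 ≤ Y := by linarith
  have hZ0 : 0 ≤ Z := by linarith
  have hh := cofactorForm_nonneg hα.1 hβ.1 hγ hX0 hY0 hZ0
  have hQ := gramForm_pos hα hβ hγ hX hY hZ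
  have hXe : X ≤ √(sideForm γ X Y) := le_sqrt_of_sq_le (sq_le_sideForm hγ.1 hX0 hY)
  have hYe : Y ≤ √(sideForm γ X Y) :=
    le_sqrt_of_sq_le (sideForm_comm γ X Y ▸ sq_le_sideForm hγ.1 hY0 hX)
  calc t * cofactorForm α β γ X Y Z * √(sideForm β X Z)
      ≤ t * cofactorForm α β γ X Y Z * (X + Z) := by
        gcongr
        exact sqrt_sideForm_le_add hβ hX0 hZ0
    _ ≤ 3 / 2 * (gramQuadratic α β γ X Y Z * √(sideForm γ X Y)) :=
        cofactorForm_mul_add_le hα hβ hγ hX0 hY0 hZ0 ht htY (htY.trans hYe) hXe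
    _ ≤ 3 / 2 * (2 * gramForm α β γ X Y Z * √(sideForm γ X Y)) := by
        gcongr
        linarith [gramQuadratic_le hα hβ hγ hX hY hZ]
    _ = _ := by ring

end Bounds

section Angle

variable {V : Type*} {α β γ x y z : ℝ}

theorem abs_div_sqrt_lt_one {a b : ℝ} (h : a ^ 2 < b) : |a / √b| < 1 := by
  have hb : 0 < √b := sqrt_pos.2 ((sq_nonneg a).trans_lt h)
  rw [abs_div, abs_of_pos hb, div_lt_one hb]
  exact lt_sqrt_of_sq_lt (by rwa [sq_abs])

theorem hasDerivAt_arccos_div_sqrt {N E : ℝ → ℝ} {N' E' s : ℝ} (hN : HasDerivAt N N' s)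
    (hE : HasDerivAt E E' s) (hNE : N s ^ 2 < E s) :
    HasDerivAt (fun t => arccos (N t / √(E t)))
      ((N s * (E' / 2) - N' * E s) / (E s * √(E s - N s ^ 2))) s := by
  have hE0 : 0 < E s := (sq_nonneg _).trans_lt hNE
  have hr : 0 < √(E s) := sqrt_pos.2 hE0
  obtain ⟨hlower, hupper⟩ := abs_lt.1 (abs_div_sqrt_lt_one hNE)
  have hsin : √(1 - (N s / √(E s)) ^ 2) = √(E s - N s ^ 2) / √(E s) := by
    rw [← sqrt_div' _ hE0.le, div_pow, sq_sqrt hE0.le, sub_div, div_self hE0.ne']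
  refine ((hasDerivAt_arccos hlower.ne' hupper.ne).comp s
    (hN.div (hE.sqrt hE0.ne') hr.ne')).congr_deriv ?_
  have hD : 0 < √(E s - N s ^ 2) := sqrt_pos.2 (sub_pos.2 hNE)
  have hrE : √(E s) ^ 2 = E s := sq_sqrt hE0.le
  rw [hsin]
  generalize √(E s - N s ^ 2) = d at *
  generalize √(E s) = r at *
  rw [← hrE]
  field_simp
  ring

theorem sinh_radius {u : ℝ} (hu : u < 0) : sinh (radius u) = -1 / sinh u := by
  have he : exp u ∈ Ioo (-1) 1 := ⟨by linarith [exp_pos u], exp_lt_one_iff.2 hu⟩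
  have he2 : 0 < 1 - exp u ^ 2 := by nlinarith [exp_pos u, he.2]
  have hu' : exp u ^ 2 - 1 ≠ 0 := by linarith
  rw [radius, sinh_two_mul, sinh_artanh he, cosh_artanh he, sinh_eq u, exp_neg]
  field_simp
  rw [sq_sqrt he2.le]
  ring

theorem cosh_radius {u : ℝ} (hu : u < 0) : cosh (radius u) = -cosh u / sinh u := by
  have he : exp u ∈ Ioo (-1) 1 := ⟨by linarith [exp_pos u], exp_lt_one_iff.2 hu⟩
  have he2 : 0 < 1 - exp u ^ 2 := by nlinarith [exp_pos u, he.2]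
  have hu' : exp u ^ 2 - 1 ≠ 0 := by linarith
  rw [radius, cosh_two_mul, sinh_artanh he, cosh_artanh he, sinh_eq u, cosh_eq u, exp_neg]
  field_simp
  rw [sq_sqrt he2.le]
  ring

/-- The angle at the center of circle `1`, for circles with conformal factors `x`, `y`, `z`, and
`α`, `β`, `γ` as in `cosNum`. -/
def angle (α β γ x y z : ℝ) : ℝ :=
  arccos (cosNum α β γ (cosh x) (cosh y) (cosh z) /
    √(sideForm γ (cosh x) (cosh y) * sideForm β (cosh x) (cosh z)))

theorem angle_swap (α β γ x y z : ℝ) : angle α γ β x z y = angle α β γ x y z := by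
  rw [angle, angle, cosNum_swap, mul_comm]

theorem sinh_mul_sinh_le (x y : ℝ) : sinh x * sinh y ≤ cosh x * cosh y := by
  linarith [cosh_sub x y, one_le_cosh (x - y)]

theorem one_le_mul_cosh_add_div (hγ : 0 ≤ γ) (hx : x < 0) (hy : y < 0) :
    1 ≤ (cosh x * cosh y + γ) / (sinh x * sinh y) := by
  rw [one_le_div (mul_pos_of_neg_of_neg (sinh_neg_iff.2 hx) (sinh_neg_iff.2 hy))]
  linarith [sinh_mul_sinh_le x y]

theorem edgeLength_radius (Φ : Sym2 V → ℝ) {u : V → ℝ} {i j : V} (hi : u i < 0) (hj : u j < 0) :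
    edgeLength Φ (fun v => radius (u v)) i j
      = arcosh ((cosh (u i) * cosh (u j) + cos (Φ s(i, j))) / (sinh (u i) * sinh (u j))) := by
  have hi0 := (sinh_neg_iff.2 hi).ne
  have hj0 := (sinh_neg_iff.2 hj).ne
  rw [edgeLength, cosh_radius hi, cosh_radius hj, sinh_radius hi, sinh_radius hj]
  congr 1
  field_simp

theorem sinh_edgeLength_radius (Φ : Sym2 V → ℝ) {u : V → ℝ} {i j : V}
    (hΦ : 0 ≤ cos (Φ s(i, j))) (hi : u i < 0) (hj : u j < 0) :
    sinh (edgeLength Φ (fun v => radius (u v)) i j)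
      = √(sideForm (cos (Φ s(i, j))) (cosh (u i)) (cosh (u j))) / (sinh (u i) * sinh (u j)) := by
  have hsinh := mul_pos_of_neg_of_neg (sinh_neg_iff.2 hi) (sinh_neg_iff.2 hj)
  rw [edgeLength_radius Φ hi hj, sinh_arcosh (one_le_mul_cosh_add_div hΦ hi hj), sideForm_eq,
    ← sinh_sq, ← sinh_sq, ← mul_pow, div_pow, div_sub_one (pow_pos hsinh 2).ne',
    sqrt_div' _ (sq_nonneg _), sqrt_sq hsinh.le]

theorem innerAngle_radius (Φ : Sym2 V → ℝ) {u : V → ℝ} {i j k : V}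
    (hjk : 0 ≤ cos (Φ s(j, k))) (hik : 0 ≤ cos (Φ s(i, k))) (hij : 0 ≤ cos (Φ s(i, j)))
    (hi : u i < 0) (hj : u j < 0) (hk : u k < 0) :
    innerAngle Φ (fun v => radius (u v)) i j k =
      angle (cos (Φ s(j, k))) (cos (Φ s(i, k))) (cos (Φ s(i, j))) (u i) (u j) (u k) := by
  have hi0 := (sinh_neg_iff.2 hi).ne
  have hj0 := (sinh_neg_iff.2 hj).ne
  have hk0 := (sinh_neg_iff.2 hk).ne
  rw [innerAngle, hyperbolicAngle, angle, sinh_edgeLength_radius Φ hij hi hj,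
    sinh_edgeLength_radius Φ hik hi hk, edgeLength_radius Φ hi hj, edgeLength_radius Φ hi hk,
    edgeLength_radius Φ hj hk, cosh_arcosh (one_le_mul_cosh_add_div hij hi hj),
    cosh_arcosh (one_le_mul_cosh_add_div hik hi hk),
    cosh_arcosh (one_le_mul_cosh_add_div hjk hj hk),
    sqrt_mul (sideForm_pos hij (one_le_cosh _) (one_le_cosh _)).le, cosNum_eq, cosh_sq]
  congr 1
  field_simp
  ring

end Angle

section AngleDeriv

variable {α β γ x y z : ℝ}

theorem cosNum_sq_lt (hα : α ∈ Icc (0 : ℝ) 1) (hβ : β ∈ Icc (0 : ℝ) 1) (hγ : γ ∈ Icc (0 : ℝ) 1)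
    (hx : x ≠ 0) :
    cosNum α β γ (cosh x) (cosh y) (cosh z) ^ 2
      < sideForm γ (cosh x) (cosh y) * sideForm β (cosh x) (cosh z) := by
  rw [← sub_pos, sideForm_mul_sideForm_sub_cosNum_sq]
  have := one_lt_cosh.2 hx
  exact mul_pos (by nlinarith)
    (gramForm_pos hα hβ hγ (one_le_cosh x) (one_le_cosh y) (one_le_cosh z))

theorem angle_nonneg (α β γ x y z : ℝ) : 0 ≤ angle α β γ x y z := arccos_nonneg _

theorem angle_pos (hα : α ∈ Icc (0 : ℝ) 1) (hβ : β ∈ Icc (0 : ℝ) 1) (hγ : γ ∈ Icc (0 : ℝ) 1)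
    (hx : x ≠ 0) : 0 < angle α β γ x y z :=
  arccos_pos.2 (abs_lt.1 (abs_div_sqrt_lt_one (cosNum_sq_lt hα hβ hγ hx))).2

theorem sin_angle (hα : α ∈ Icc (0 : ℝ) 1) (hβ : β ∈ Icc (0 : ℝ) 1) (hγ : γ ∈ Icc (0 : ℝ) 1)
    (hx : x < 0) :
    sin (angle α β γ x y z) = -sinh x * √(gramForm α β γ (cosh x) (cosh y) (cosh z))
      / (√(sideForm γ (cosh x) (cosh y)) * √(sideForm β (cosh x) (cosh z))) := by
  have hE : 0 < sideForm γ (cosh x) (cosh y) * sideForm β (cosh x) (cosh z) :=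
    (sq_nonneg _).trans_lt (cosNum_sq_lt hα hβ hγ hx.ne)
  have hsinh : 0 ≤ -sinh x := by linarith [sinh_neg_iff.2 hx]
  rw [angle, sin_arccos, div_pow, sq_sqrt hE.le, one_sub_div hE.ne',
    sideForm_mul_sideForm_sub_cosNum_sq, ← sinh_sq, sqrt_div' _ hE.le, sqrt_mul (sq_nonneg _),
    sqrt_mul (sideForm_pos hγ.1 (one_le_cosh x) (one_le_cosh y)).le, ← neg_sq, sqrt_sq hsinh]

/-- The factor `p` in `∂θ/∂y = p * sinh x * sinh y`, where `θ` is `angle α β γ x y z`. The part of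
`-∂θ/∂x` that comes from the side between `1` and `2` is `p * (cosh x * cosh y + γ)`. -/
def angleWeight (α β γ x y z : ℝ) : ℝ :=
  cofactorForm α β γ (cosh x) (cosh y) (cosh z) /
    (sideForm γ (cosh x) (cosh y) * √(gramForm α β γ (cosh x) (cosh y) (cosh z)))

theorem angleWeight_nonneg (hα : 0 ≤ α) (hβ : 0 ≤ β) (hγ : γ ∈ Icc (0 : ℝ) 1) :
    0 ≤ angleWeight α β γ x y z :=
  div_nonneg (cofactorForm_nonneg hα hβ hγ (cosh_pos x).le (cosh_pos y).le (cosh_pos z).le)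
    (mul_nonneg (sideForm_pos hγ.1 (one_le_cosh x) (one_le_cosh y)).le (sqrt_nonneg _))

theorem angleWeight_mul_le_six (hα : α ∈ Icc (0 : ℝ) 1) (hβ : β ∈ Icc (0 : ℝ) 1)
    (hγ : γ ∈ Icc (0 : ℝ) 1) : angleWeight α β γ x y z * (cosh x * cosh y + γ) ≤ 6 := by
  have hx := one_le_cosh x
  have hy := one_le_cosh y
  have hz := one_le_cosh z
  rw [angleWeight, div_mul_eq_mul_div, mul_comm (cofactorForm _ _ _ _ _ _), div_le_iff₀
    (mul_pos (sideForm_pos hγ.1 hx hy) (sqrt_pos.2 (gramForm_pos hα hβ hγ hx hy hz)))]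
  exact mul_add_mul_cofactorForm_le hα hβ hγ hx hy hz

theorem angleWeight_mul_sinh_le (hα : 0 ≤ α) (hβ : 0 ≤ β) (hγ : γ ∈ Icc (0 : ℝ) 1) :
    angleWeight α β γ x y z * (sinh x * sinh y)
      ≤ angleWeight α β γ x y z * (cosh x * cosh y + γ) :=
  mul_le_mul_of_nonneg_left (by linarith [sinh_mul_sinh_le x y, hγ.1])
    (angleWeight_nonneg hα hβ hγ)

theorem angleWeight_mul_sinh_le_angle (hα : α ∈ Icc (0 : ℝ) 1) (hβ : β ∈ Icc (0 : ℝ) 1)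
    (hγ : γ ∈ Icc (0 : ℝ) 1) (hx : x < 0) (hy : y < 0) :
    angleWeight α β γ x y z * (sinh x * sinh y) ≤ 3 * angle α β γ x y z := by
  have hX := one_le_cosh x
  have hY := one_le_cosh y
  have hZ := one_le_cosh z
  have hE := sideForm_pos hγ.1 hX hY
  have hE' := sideForm_pos hβ.1 hX hZ
  have hQ := gramForm_pos hα hβ hγ hX hY hZ
  have hsinh : 0 ≤ -sinh x := by linarith [sinh_neg_iff.2 hx]
  have hnum := cofactorForm_mul_sqrt_le hα hβ hγ hX hY hZ
    (by linarith [sinh_neg_iff.2 hy] : 0 ≤ -sinh y) (by linarith [cosh_add_sinh y, exp_pos y])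
  refine le_trans ?_ (mul_le_mul_of_nonneg_left (sin_le (angle_nonneg α β γ x y z)) zero_le_three)
  rw [sin_angle hα hβ hγ hx, angleWeight]
  generalize sideForm γ (cosh x) (cosh y) = E at *
  generalize sideForm β (cosh x) (cosh z) = E' at *
  generalize gramForm α β γ (cosh x) (cosh y) (cosh z) = Q at *
  calc cofactorForm α β γ (cosh x) (cosh y) (cosh z) / (E * √Q) * (sinh x * sinh y)
      = -sinh x * (-sinh y * cofactorForm α β γ (cosh x) (cosh y) (cosh z) * √E')
          / (E * √Q * √E') := by field_simp
    _ ≤ -sinh x * (3 * (Q * √E)) / (E * √Q * √E') := by gcongr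
    _ = 3 * (-sinh x * √Q / (√E * √E')) := by
        nth_rewrite 1 [← sq_sqrt hQ.le]
        nth_rewrite 2 [← sq_sqrt hE.le]
        field_simp

theorem hasDerivAt_sideForm {x y : ℝ → ℝ} {x' y' s : ℝ} (hx : HasDerivAt x x' s)
    (hy : HasDerivAt y y' s) :
    HasDerivAt (fun t => sideForm γ (cosh (x t)) (cosh (y t)))
      (2 * ((cosh (x s) + γ * cosh (y s)) * (sinh (x s) * x')
        + (cosh (y s) + γ * cosh (x s)) * (sinh (y s) * y'))) s := by
  refine (((((hx.cosh.pow 2).add (hy.cosh.pow 2)).add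
    ((hx.cosh.const_mul (2 * γ)).mul hy.cosh)).add_const (γ ^ 2)).sub_const 1).congr_deriv ?_
  ring

theorem hasDerivAt_cosNum {x y z : ℝ → ℝ} {x' y' z' s : ℝ} (hx : HasDerivAt x x' s)
    (hy : HasDerivAt y y' s) (hz : HasDerivAt z z' s) :
    HasDerivAt (fun t => cosNum α β γ (cosh (x t)) (cosh (y t)) (cosh (z t)))
      ((β * cosh (y s) + γ * cosh (z s) - 2 * α * cosh (x s)) * (sinh (x s) * x')
        + (cosh (z s) + β * cosh (x s)) * (sinh (y s) * y')
        + (cosh (y s) + γ * cosh (x s)) * (sinh (z s) * z')) s := by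
  refine (((((hy.cosh.mul hz.cosh).add ((hx.cosh.const_mul β).mul hy.cosh)).add
    ((hx.cosh.const_mul γ).mul hz.cosh)).add_const (β * γ)).add
    (((hx.cosh.pow 2).const_sub 1).const_mul α)).congr_deriv ?_
  ring

theorem hasDerivAt_angle (hα : α ∈ Icc (0 : ℝ) 1) (hβ : β ∈ Icc (0 : ℝ) 1)
    (hγ : γ ∈ Icc (0 : ℝ) 1) {x y z : ℝ → ℝ} {x' y' z' s : ℝ} (hx : HasDerivAt x x' s)
    (hy : HasDerivAt y y' s) (hz : HasDerivAt z z' s) (hxs : x s < 0) :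
    HasDerivAt (fun t => angle α β γ (x t) (y t) (z t))
      (angleWeight α β γ (x s) (y s) (z s) *
          (sinh (x s) * sinh (y s) * y' - (cosh (x s) * cosh (y s) + γ) * x')
        + angleWeight α γ β (x s) (z s) (y s) *
          (sinh (x s) * sinh (z s) * z' - (cosh (x s) * cosh (z s) + β) * x')) s := by
  refine (hasDerivAt_arccos_div_sqrt (hasDerivAt_cosNum hx hy hz)
    ((hasDerivAt_sideForm hx hy).mul (hasDerivAt_sideForm hx hz))
    (cosNum_sq_lt hα hβ hγ hxs.ne)).congr_deriv ?_
  have hX := one_le_cosh (x s)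
  have hY := one_le_cosh (y s)
  have hZ := one_le_cosh (z s)
  have hE₁₂ := sideForm_pos hγ.1 hX hY
  have hE₁₃ := sideForm_pos hβ.1 hX hZ
  have hQ := sqrt_pos.2 (gramForm_pos hα hβ hγ hX hY hZ)
  have hsinh : 0 < -sinh (x s) := by linarith [sinh_neg_iff.2 hxs]
  have hy' := sideForm_mul_sub_cosNum_mul α β γ (cosh (x s)) (cosh (y s)) (cosh (z s))
  have hz' := sideForm_mul_sub_cosNum_mul α γ β (cosh (x s)) (cosh (z s)) (cosh (y s))
  have hx' := cosNum_mul_sub_sideForm_mul α β γ (cosh (x s)) (cosh (y s)) (cosh (z s))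
  rw [← sinh_sq] at hy' hz'
  rw [cosNum_swap] at hz'
  simp only [Pi.mul_apply]
  rw [sideForm_mul_sideForm_sub_cosNum_sq, ← sinh_sq, ← neg_sq (sinh (x s)),
    sqrt_mul (sq_nonneg _), sqrt_sq hsinh.le, angleWeight, angleWeight, gramForm_swap α β γ,
    div_eq_iff (mul_pos (mul_pos hE₁₂ hE₁₃) (mul_pos hsinh hQ)).ne']
  field_simp
  linear_combination (sinh (x s) * x') * hx'
    - (sinh (y s) * y' * sideForm β (cosh (x s)) (cosh (z s))) * hy'
    - (sinh (z s) * z' * sideForm γ (cosh (x s)) (cosh (y s))) * hz'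

end AngleDeriv

section AngleComparison

variable {α β γ : ℝ}

theorem angle_le_arccos (hα : α ≤ 1) (hβ : 0 ≤ β) (hγ : 0 ≤ γ) {x y z : ℝ}
    (hx : 2 * sinh x ^ 2 ≤ 1) : angle α β γ x y z ≤ arccos (1 - 2 * sinh x ^ 2) := by
  have hX := one_le_cosh x
  have hY := one_le_cosh y
  have hZ := one_le_cosh z
  have hE₁₂ := sideForm_pos hγ hX hY
  have hE₁₃ := sideForm_pos hβ hX hZ
  refine arccos_le_arccos ?_
  rw [le_div_iff₀ (sqrt_pos.2 (mul_pos hE₁₂ hE₁₃)), sqrt_mul hE₁₂.le, cosNum_eq, ← sinh_sq]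
  have hYZ : cosh y * cosh z + α
      ≤ 2 * ((cosh x * cosh z + β) * (cosh x * cosh y + γ)) := by
    have h₁ : cosh z ≤ cosh x * cosh z + β := by nlinarith
    have h₂ : cosh y ≤ cosh x * cosh y + γ := by nlinarith
    nlinarith [mul_le_mul h₁ h₂ (by linarith) (by linarith)]
  calc (1 - 2 * sinh x ^ 2) * (√(sideForm γ (cosh x) (cosh y)) * √(sideForm β (cosh x) (cosh z)))
      ≤ (1 - 2 * sinh x ^ 2) * ((cosh x * cosh y + γ) * (cosh x * cosh z + β)) := by
        have h₁₂ := sqrt_sideForm_le_mul_add hγ hX hY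
        have h₁₃ := sqrt_sideForm_le_mul_add hβ hX hZ
        have : 0 ≤ 1 - 2 * sinh x ^ 2 := by linarith
        gcongr
    _ ≤ (cosh x * cosh z + β) * (cosh x * cosh y + γ) - sinh x ^ 2 * (cosh y * cosh z + α) := by
        linarith [mul_le_mul_of_nonneg_left hYZ (sq_nonneg (sinh x))]

theorem contDiffAt_angle {n : WithTop ℕ∞} (hα : α ∈ Icc (0 : ℝ) 1) (hβ : β ∈ Icc (0 : ℝ) 1)
    (hγ : γ ∈ Icc (0 : ℝ) 1) {p : ℝ × ℝ × ℝ} (hp : p.1 ≠ 0) :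
    ContDiffAt ℝ n (fun p : ℝ × ℝ × ℝ => angle α β γ p.1 p.2.1 p.2.2) p := by
  have hE := cosNum_sq_lt (y := p.2.1) (z := p.2.2) hα hβ hγ hp
  have hE0 := (sq_nonneg _).trans_lt hE
  obtain ⟨hlower, hupper⟩ := abs_lt.1 (abs_div_sqrt_lt_one hE)
  refine ContDiffAt.comp (g := arccos) p (contDiffAt_arccos hlower.ne' hupper.ne) ?_
  refine ContDiffAt.div (ContDiff.contDiffAt ?_) (ContDiffAt.sqrt (ContDiff.contDiffAt ?_) hE0.ne')
    (sqrt_pos.2 hE0).ne'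
  · unfold cosNum
    fun_prop
  · unfold sideForm
    fun_prop

theorem exists_hasDerivAt_angle (hα : α ∈ Icc (0 : ℝ) 1) (hβ : β ∈ Icc (0 : ℝ) 1)
    (hγ : γ ∈ Icc (0 : ℝ) 1) {x y z : ℝ → ℝ} {x' y' z' s : ℝ} (hx : HasDerivAt x x' s)
    (hy : HasDerivAt y y' s) (hz : HasDerivAt z z' s) (hx0 : x s < 0) (hy0 : y s < 0)
    (hz0 : z s < 0) :
    ∃ a b d e, (0 ≤ a ∧ a ≤ d ∧ d ≤ 6 ∧ a ≤ 3 * angle α β γ (x s) (y s) (z s)) ∧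
      (0 ≤ b ∧ b ≤ e ∧ e ≤ 6 ∧ b ≤ 3 * angle α β γ (x s) (y s) (z s)) ∧
      HasDerivAt (fun t => angle α β γ (x t) (y t) (z t)) (a * y' + b * z' - (d + e) * x') s := by
  have hbounds {β γ y z : ℝ} (hβ : β ∈ Icc (0 : ℝ) 1) (hγ : γ ∈ Icc (0 : ℝ) 1) (hy : y < 0) :
      0 ≤ angleWeight α β γ (x s) y z * (sinh (x s) * sinh y) ∧
      angleWeight α β γ (x s) y z * (sinh (x s) * sinh y)
        ≤ angleWeight α β γ (x s) y z * (cosh (x s) * cosh y + γ) ∧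
      angleWeight α β γ (x s) y z * (cosh (x s) * cosh y + γ) ≤ 6 ∧
      angleWeight α β γ (x s) y z * (sinh (x s) * sinh y) ≤ 3 * angle α β γ (x s) y z :=
    ⟨mul_nonneg (angleWeight_nonneg hα.1 hβ.1 hγ)
        (mul_pos_of_neg_of_neg (sinh_neg_iff.2 hx0) (sinh_neg_iff.2 hy)).le,
      angleWeight_mul_sinh_le hα.1 hβ.1 hγ, angleWeight_mul_le_six hα hβ hγ,
      angleWeight_mul_sinh_le_angle hα hβ hγ hx0 hy⟩
  refine ⟨_, _, _, _, hbounds hβ hγ hy0, angle_swap α β γ _ _ _ ▸ hbounds hγ hβ hz0,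
    (hasDerivAt_angle hα hβ hγ hx hy hz hx0).congr_deriv ?_⟩
  ring

variable {x y z x₁ y₁ z₁ : ℝ}
  (hα : α ∈ Icc (0 : ℝ) 1) (hβ : β ∈ Icc (0 : ℝ) 1) (hγ : γ ∈ Icc (0 : ℝ) 1)
  (hx : x < 0) (hy : y < 0) (hz : z < 0) (hx₁ : x₁ < 0) (hy₁ : y₁ < 0) (hz₁ : z₁ < 0)

include hα hβ hγ hx hy hz hx₁ hy₁ hz₁

theorem exists_comp_angle_sub_eq {F : ℝ → ℝ} (hF : ∀ t, 0 < t → DifferentiableAt ℝ F t) :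
    ∃ θ, 0 < θ ∧ ∃ a b d e, (0 ≤ a ∧ a ≤ d ∧ d ≤ 6 ∧ a ≤ 3 * θ) ∧
      (0 ≤ b ∧ b ≤ e ∧ e ≤ 6 ∧ b ≤ 3 * θ) ∧
      F (angle α β γ x₁ y₁ z₁) - F (angle α β γ x y z)
        = deriv F θ * (a * (y₁ - y) + b * (z₁ - z) - (d + e) * (x₁ - x)) := by
  set θ : ℝ → ℝ := fun s =>
    angle α β γ (AffineMap.lineMap x x₁ s) (AffineMap.lineMap y y₁ s) (AffineMap.lineMap z z₁ s)
    with hθ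
  have hneg {p q s : ℝ} (hp : p < 0) (hq : q < 0) (hs : s ∈ Icc (0 : ℝ) 1) :
      AffineMap.lineMap p q s < 0 := (convex_Iio (0 : ℝ)).lineMap_mem hp hq hs
  have hpos (s) (hs : s ∈ Icc (0 : ℝ) 1) : 0 < θ s := angle_pos hα hβ hγ (hneg hx hx₁ hs).ne
  choose! a b d e ha hb hderiv using fun s (hs : s ∈ Icc (0 : ℝ) 1) =>
    exists_hasDerivAt_angle hα hβ hγ AffineMap.hasDerivAt_lineMap AffineMap.hasDerivAt_lineMap
      AffineMap.hasDerivAt_lineMap (hneg hx hx₁ hs) (hneg hy hy₁ hs) (hneg hz hz₁ hs)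
  have hcomp (s) (hs : s ∈ Icc (0 : ℝ) 1) :=
    (hF (θ s) (hpos s hs)).hasDerivAt.comp s (hderiv s hs)
  obtain ⟨s, hs, hslope⟩ := exists_hasDerivAt_eq_slope (F ∘ θ) _ zero_lt_one
    (fun s hs => (hcomp s hs).continuousAt.continuousWithinAt)
    (fun s hs => hcomp s (Ioo_subset_Icc_self hs))
  have hs := Ioo_subset_Icc_self hs
  refine ⟨θ s, hpos s hs, a s, b s, d s, e s, ha s hs, hb s hs, ?_⟩
  simpa [hθ] using hslope.symm

theorem exists_angle_sub_eq :
    ∃ a b d e, (0 ≤ a ∧ a ≤ d ∧ d ≤ 6) ∧ (0 ≤ b ∧ b ≤ e ∧ e ≤ 6) ∧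
      angle α β γ x₁ y₁ z₁ - angle α β γ x y z
        = a * (y₁ - y) + b * (z₁ - z) - (d + e) * (x₁ - x) := by
  obtain ⟨_, _, a, b, d, e, ⟨ha, had, hd, -⟩, ⟨hb, hbe, he, -⟩, h⟩ :=
    exists_comp_angle_sub_eq hα hβ hγ hx hy hz hx₁ hy₁ hz₁ fun _ _ => differentiableAt_id
  exact ⟨a, b, d, e, ⟨ha, had, hd⟩, ⟨hb, hbe, he⟩, by simpa using h⟩

theorem angle_add_mul_mono (hxx : x ≤ x₁) (hyy : y ≤ y₁) (hzz : z ≤ z₁) :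
    angle α β γ x y z + 12 * x ≤ angle α β γ x₁ y₁ z₁ + 12 * x₁ := by
  obtain ⟨a, b, d, e, ⟨ha, -, hd⟩, ⟨hb, -, he⟩, h⟩ :=
    exists_angle_sub_eq hα hβ hγ hx hy hz hx₁ hy₁ hz₁
  have hx' : (d + e) * (x₁ - x) ≤ 12 * (x₁ - x) :=
    mul_le_mul_of_nonneg_right (by linarith) (sub_nonneg.2 hxx)
  have hy' := mul_nonneg ha (sub_nonneg.2 hyy)
  have hz' := mul_nonneg hb (sub_nonneg.2 hzz)
  linarith

theorem angle_add_mul_le {m : ℝ} (hm : 0 ≤ m) (hxm : x₁ - x ≤ m) (hym : y₁ - y ≤ m)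
    (hzm : z₁ - z ≤ m) :
    angle α β γ x₁ y₁ z₁ + 12 * x₁ ≤ angle α β γ x y z + 12 * x + 12 * m := by
  obtain ⟨a, b, d, e, ⟨ha, had, hd⟩, ⟨hb, hbe, he⟩, h⟩ :=
    exists_angle_sub_eq hα hβ hγ hx hy hz hx₁ hy₁ hz₁
  have hx' := mul_le_mul_of_nonneg_left hxm (by linarith : 0 ≤ 12 - (d + e))
  have hy' := mul_le_mul_of_nonneg_left hym ha
  have hz' := mul_le_mul_of_nonneg_left hzm hb
  have hm' := mul_le_mul_of_nonneg_right (add_le_add had hbe) hm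
  linarith

-- A Harnack inequality: the angle bounds its own derivatives, so `log angle` is Lipschitz.
theorem angle_le_mul_exp {m : ℝ} (hm : 0 ≤ m) (hxx : x ≤ x₁) (hym : y₁ - y ≤ m)
    (hzm : z₁ - z ≤ m) :
    angle α β γ x₁ y₁ z₁ ≤ angle α β γ x y z * exp (6 * m) := by
  have hpos := angle_pos (y := y) (z := z) hα hβ hγ hx.ne
  have hpos₁ := angle_pos (y := y₁) (z := z₁) hα hβ hγ hx₁.ne
  obtain ⟨θ, hθ, a, b, d, e, ⟨ha, had, -, haθ⟩, ⟨hb, hbe, -, hbθ⟩, h⟩ :=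
    exists_comp_angle_sub_eq hα hβ hγ hx hy hz hx₁ hy₁ hz₁
      fun t ht => differentiableAt_log ht.ne'
  have hlog : log (angle α β γ x₁ y₁ z₁) - log (angle α β γ x y z) ≤ 6 * m := by
    rw [h, deriv_log, inv_mul_le_iff₀ hθ]
    have hx' := mul_nonneg (by linarith : 0 ≤ d + e) (sub_nonneg.2 hxx)
    have hy' := mul_le_mul_of_nonneg_left hym ha
    have hz' := mul_le_mul_of_nonneg_left hzm hb
    have hm' := mul_le_mul_of_nonneg_right (add_le_add haθ hbθ) hm
    linarith
  rw [← div_le_iff₀' hpos, ← log_le_iff_le_exp (div_pos hpos₁ hpos), log_div hpos₁.ne' hpos.ne']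
  exact hlog

end AngleComparison

section Curvature

variable {V : Type*} {T : AbstractSimplicialComplex V} {Φ : Sym2 V → ℝ} {i : V} {u v : V → ℝ}

theorem IsFace.mem_edges {j k : V} (h : IsFace T i j k) :
    s(j, k) ∈ edges T ∧ s(i, k) ∈ edges T ∧ s(i, j) ∈ edges T := by
  classical
  obtain ⟨hij, hik, hjk, σ, hσ, hs⟩ := h
  have hedge {a b : V} (hab : a ≠ b) (ha : a ∈ (σ : Set V)) (hb : b ∈ (σ : Set V)) :
      s(a, b) ∈ edges T :=
    ⟨a, b, hab, rfl, {a, b}, T.isRelLowerSet_faces.mem_of_le hσ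
      (Finset.insert_subset ha (Finset.singleton_subset_iff.2 hb)) (Finset.insert_nonempty _ _),
      by simp⟩
  exact ⟨hedge hjk (by simp [hs]) (by simp [hs]), hedge hik (by simp [hs]) (by simp [hs]),
    hedge hij (by simp [hs]) (by simp [hs])⟩

theorem IsFace.swap {j k : V} (h : IsFace T i j k) : IsFace T i k j := by
  obtain ⟨hij, hik, hjk, σ, hσ, hs⟩ := h
  exact ⟨hik, hij, hjk.symm, σ, hσ, hs.trans (by rw [pair_comm])⟩

theorem isFace_of_mk_mem_oppositeSides {j k : V} (h : s(j, k) ∈ oppositeSides T i) :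
    IsFace T i j k := by
  obtain ⟨j', k', he, hface⟩ := h
  rcases Sym2.eq_iff.1 he with ⟨rfl, rfl⟩ | ⟨rfl, rfl⟩
  exacts [hface, hface.swap]

/-- The inner angle at `i` in the triangle with opposite side `e`, in terms of the conformal factor
instead of the radii. The ends of `e` are taken in an arbitrary order, cf. `angle_swap`. -/
def angleOpp (Φ : Sym2 V → ℝ) (u : V → ℝ) (i : V) (e : Sym2 V) : ℝ :=
  angle (cos (Φ s(e.out.1, e.out.2))) (cos (Φ s(i, e.out.2))) (cos (Φ s(i, e.out.1)))
    (u i) (u e.out.1) (u e.out.2)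

theorem angleOpp_nonneg (Φ : Sym2 V → ℝ) (u : V → ℝ) (i : V) (e : Sym2 V) :
    0 ≤ angleOpp Φ u i e :=
  angle_nonneg ..

variable (hT : ∀ v : V, {σ : Finset V | σ ∈ T ∧ v ∈ σ}.Finite)
  (hΦ : ∀ e ∈ edges T, 0 ≤ cos (Φ e))

include hΦ in
theorem cos_mem_Icc_of_mem_oppositeSides {e : Sym2 V} (he : e ∈ oppositeSides T i) :
    cos (Φ s(e.out.1, e.out.2)) ∈ Icc (0 : ℝ) 1 ∧ cos (Φ s(i, e.out.2)) ∈ Icc (0 : ℝ) 1 ∧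
      cos (Φ s(i, e.out.1)) ∈ Icc (0 : ℝ) 1 := by
  rw [← Quot.out_eq e] at he
  obtain ⟨hjk, hik, hij⟩ := (isFace_of_mk_mem_oppositeSides he).mem_edges
  exact ⟨⟨hΦ _ hjk, cos_le_one _⟩, ⟨hΦ _ hik, cos_le_one _⟩, ⟨hΦ _ hij, cos_le_one _⟩⟩

include hΦ in
theorem innerAngleOpp_radius (hu : IsConformalFactor u) {e : Sym2 V} (he : e ∈ oppositeSides T i) :
    innerAngleOpp Φ (fun v => radius (u v)) i e = angleOpp Φ u i e := by
  obtain ⟨hjk, hik, hij⟩ := cos_mem_Icc_of_mem_oppositeSides hΦ he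
  calc innerAngleOpp Φ (fun v => radius (u v)) i e
      = innerAngle Φ (fun v => radius (u v)) i e.out.1 e.out.2 := by
        conv_lhs => rw [← Quot.out_eq e]
        rfl
    _ = angleOpp Φ u i e := innerAngle_radius Φ hjk.1 hik.1 hij.1 (hu _) (hu _) (hu _)

include hΦ

theorem K_eq_sum_angleOpp (i : V) (hu : IsConformalFactor u) :
    K T Φ u i = 2 * π - ∑ e ∈ (oppositeSides_finite T i (hT i)).toFinset, angleOpp Φ u i e := by
  rw [K, curvature, finsum_mem_eq_finite_toFinset_sum _ (oppositeSides_finite T i (hT i))]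
  congr 1
  exact Finset.sum_congr rfl fun e he => innerAngleOpp_radius hΦ hu ((Finite.mem_toFinset _).1 he)

include hT

theorem K_le_two_pi (i : V) (hu : IsConformalFactor u) : K T Φ u i ≤ 2 * π := by
  rw [K_eq_sum_angleOpp hT hΦ i hu, sub_le_self_iff]
  exact Finset.sum_nonneg fun e _ => angleOpp_nonneg Φ u i e

theorem contDiffOn_K {E : Type*} [NormedAddCommGroup E] [NormedSpace ℝ E] {n : WithTop ℕ∞}
    {s : Set E} {u : E → V → ℝ} (i : V) (hu : ∀ t ∈ s, IsConformalFactor (u t))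
    (hd : ∀ v, ContDiffOn ℝ n (fun t => u t v) s) :
    ContDiffOn ℝ n (fun t => K T Φ (u t) i) s := by
  refine ContDiffOn.congr ?_ fun t ht => K_eq_sum_angleOpp hT hΦ i (hu t ht)
  refine contDiffOn_const.sub (ContDiffOn.sum fun e he t ht => ?_)
  obtain ⟨hjk, hik, hij⟩ := cos_mem_Icc_of_mem_oppositeSides hΦ ((Finite.mem_toFinset _).1 he)
  exact ContDiffAt.comp_contDiffWithinAt (f := fun t => (u t i, u t e.out.1, u t e.out.2)) t
    (contDiffAt_angle (p := (u t i, u t e.out.1, u t e.out.2)) hjk hik hij (hu t ht i).ne)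
    ((hd i t ht).prodMk ((hd _ t ht).prodMk (hd _ t ht)))

theorem continuousOn_K (i : V) : ContinuousOn (fun u => K T Φ u i) {u | IsConformalFactor u} := by
  refine ContinuousOn.congr ?_ fun u hu => K_eq_sum_angleOpp hT hΦ i hu
  refine continuousOn_const.sub (continuousOn_finsetSum _ fun e he u hu => ?_)
  obtain ⟨hjk, hik, hij⟩ := cos_mem_Icc_of_mem_oppositeSides hΦ ((Finite.mem_toFinset _).1 he)
  have hangle := (contDiffAt_angle (n := 0) (p := (u i, u e.out.1, u e.out.2)) hjk hik hij
    (hu i).ne).continuousAt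
  exact (ContinuousAt.comp (f := fun u : V → ℝ => (u i, u e.out.1, u e.out.2)) hangle
    (by fun_prop)).continuousWithinAt

theorem K_sub_mul_anti (i : V) (hu : IsConformalFactor u) (hv : IsConformalFactor v) (huv : u ≤ v) :
    K T Φ v i - 12 * (oppositeSides T i).ncard * v i
      ≤ K T Φ u i - 12 * (oppositeSides T i).ncard * u i := by
  have hangle (e) (he : e ∈ (oppositeSides_finite T i (hT i)).toFinset) :
      angleOpp Φ u i e + 12 * u i ≤ angleOpp Φ v i e + 12 * v i := by
    obtain ⟨hjk, hik, hij⟩ := cos_mem_Icc_of_mem_oppositeSides hΦ ((Finite.mem_toFinset _).1 he)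
    exact angle_add_mul_mono hjk hik hij (hu _) (hu _) (hu _) (hv _) (hv _) (hv _) (huv _) (huv _)
      (huv _)
  have hsum := Finset.sum_le_sum hangle
  rw [K_eq_sum_angleOpp hT hΦ i hu, K_eq_sum_angleOpp hT hΦ i hv,
    ncard_eq_toFinset_card _ (oppositeSides_finite T i (hT i))]
  simp only [Finset.sum_add_distrib, Finset.sum_const, nsmul_eq_mul] at hsum
  linarith

theorem K_sub_mul_le (i : V) (hu : IsConformalFactor u) (hv : IsConformalFactor v) {m : ℝ}
    (hm : 0 ≤ m) (huv : ∀ j, v j - u j ≤ m) :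
    K T Φ u i - 12 * (oppositeSides T i).ncard * u i
      ≤ K T Φ v i - 12 * (oppositeSides T i).ncard * v i
        + 12 * (oppositeSides T i).ncard * m := by
  have hangle (e) (he : e ∈ (oppositeSides_finite T i (hT i)).toFinset) :
      angleOpp Φ v i e + 12 * v i ≤ angleOpp Φ u i e + 12 * u i + 12 * m := by
    obtain ⟨hjk, hik, hij⟩ := cos_mem_Icc_of_mem_oppositeSides hΦ ((Finite.mem_toFinset _).1 he)
    exact angle_add_mul_le hjk hik hij (hu _) (hu _) (hu _) (hv _) (hv _) (hv _) hm (huv _) (huv _)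
      (huv _)
  have hsum := Finset.sum_le_sum hangle
  rw [K_eq_sum_angleOpp hT hΦ i hu, K_eq_sum_angleOpp hT hΦ i hv,
    ncard_eq_toFinset_card _ (oppositeSides_finite T i (hT i))]
  simp only [Finset.sum_add_distrib, Finset.sum_const, nsmul_eq_mul] at hsum
  linarith

theorem two_pi_sub_K_le (i : V) (hu : IsConformalFactor u) (hv : IsConformalFactor v) {m : ℝ}
    (hm : 0 ≤ m) (hi : u i ≤ v i) (huv : ∀ j, v j - u j ≤ m) :
    2 * π - K T Φ v i ≤ (2 * π - K T Φ u i) * exp (6 * m) := by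
  rw [K_eq_sum_angleOpp hT hΦ i hu, K_eq_sum_angleOpp hT hΦ i hv, sub_sub_cancel, sub_sub_cancel,
    Finset.sum_mul]
  refine Finset.sum_le_sum fun e he => ?_
  obtain ⟨hjk, hik, hij⟩ := cos_mem_Icc_of_mem_oppositeSides hΦ ((Finite.mem_toFinset _).1 he)
  exact angle_le_mul_exp hjk hik hij (hu _) (hu _) (hu _) (hv _) (hv _) (hv _) hm hi (huv _) (huv _)

theorem two_pi_sub_card_mul_le_K (hu : IsConformalFactor u) (hi : 2 * sinh (u i) ^ 2 ≤ 1) :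
    2 * π - (oppositeSides T i).ncard * arccos (1 - 2 * sinh (u i) ^ 2) ≤ K T Φ u i := by
  rw [K_eq_sum_angleOpp hT hΦ i hu,
    ncard_eq_toFinset_card _ (oppositeSides_finite T i (hT i)), ← nsmul_eq_mul]
  refine sub_le_sub_left (Finset.sum_le_card_nsmul _ _ _ fun e he => ?_) _
  obtain ⟨hjk, hik, hij⟩ := cos_mem_Icc_of_mem_oppositeSides hΦ ((Finite.mem_toFinset _).1 he)
  exact angle_le_arccos hjk.2 hik.1 hij.1 hi

theorem exists_le_K (i : V) {κ a : ℝ} (hκ : κ < 2 * π) (ha : a < 0) :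
    ∃ b, a ≤ b ∧ b < 0 ∧ ∀ u : V → ℝ, IsConformalFactor u → u i = b → κ ≤ K T Φ u i := by
  have hbound : ∀ᶠ x in 𝓝 (0 : ℝ),
      κ < 2 * π - (oppositeSides T i).ncard * arccos (1 - 2 * sinh x ^ 2) := by
    refine Tendsto.eventually_const_lt hκ ?_
    exact Continuous.tendsto' (by fun_prop) 0 _ (by simp)
  have hsmall : ∀ᶠ x in 𝓝 (0 : ℝ), 2 * sinh x ^ 2 < 1 := by
    refine Tendsto.eventually_lt_const zero_lt_one ?_
    exact Continuous.tendsto' (by fun_prop) 0 _ (by simp)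
  obtain ⟨b, ⟨hκb, hb⟩, hab, hb0⟩ :=
    (((hbound.and hsmall).filter_mono nhdsWithin_le_nhds).and (Ioo_mem_nhdsLT ha)).exists
  refine ⟨b, hab.le, hb0, fun u hu hub => hκb.le.trans ?_⟩
  subst hub
  exact two_pi_sub_card_mul_le_K hT hΦ hu hb.le

end Curvature

section LinearEquation

open MeasureTheory

/-- The solution of `φ' = -L φ + G` with `φ 0 = x`, by variation of constants. -/
def linearSolution (L x : ℝ) (G : ℝ → ℝ) (t : ℝ) : ℝ :=
  exp (-(L * t)) * (x + ∫ s in (0 : ℝ)..t, exp (L * s) * G s)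

variable {L x y t : ℝ} {G H : ℝ → ℝ}

theorem linearSolution_zero (L x : ℝ) (G : ℝ → ℝ) : linearSolution L x G 0 = x := by
  simp [linearSolution]

theorem intervalIntegrable_exp_mul {p q : ℝ} (L : ℝ) (hG : IntervalIntegrable G volume p q) :
    IntervalIntegrable (fun s => exp (L * s) * G s) volume p q :=
  hG.continuousOn_mul (by fun_prop)

theorem linearSolution_mono (hxy : x ≤ y) (ht : 0 ≤ t) (hG : IntervalIntegrable G volume 0 t)
    (hH : IntervalIntegrable H volume 0 t) (hGH : ∀ s ∈ Icc 0 t, G s ≤ H s) :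
    linearSolution L x G t ≤ linearSolution L y H t := by
  have hint := intervalIntegral.integral_mono_on ht (intervalIntegrable_exp_mul L hG)
    (intervalIntegrable_exp_mul L hH)
    fun s hs => mul_le_mul_of_nonneg_left (hGH s hs) (exp_pos _).le
  unfold linearSolution
  gcongr

theorem linearSolution_add_affine (c m : ℝ) (hG : IntervalIntegrable G volume 0 t) :
    linearSolution L (x + c) (fun s => G s + (m + L * (c + m * s))) t
      = linearSolution L x G t + (c + m * t) := by
  have hderiv (s : ℝ) : HasDerivAt (fun s => exp (L * s) * (c + m * s))
      (exp (L * s) * (m + L * (c + m * s))) s :=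
    (((hasDerivAt_id s).const_mul L).exp.mul
      (((hasDerivAt_id s).const_mul m).const_add c)).congr_deriv (by simp only [id]; ring)
  have hint : IntervalIntegrable (fun s => exp (L * s) * (m + L * (c + m * s))) volume 0 t :=
    Continuous.intervalIntegrable (by fun_prop) _ _
  have haffine := intervalIntegral.integral_eq_sub_of_hasDerivAt (fun s _ => hderiv s) hint
  have hexp : exp (-(L * t)) * exp (L * t) = 1 := by rw [← exp_add]; simp
  simp only [linearSolution, mul_add (exp (L * _)) (G _)]
  rw [intervalIntegral.integral_add (intervalIntegrable_exp_mul L hG) hint, haffine]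
  simp only [mul_zero, exp_zero, one_mul, add_zero]
  linear_combination (c + m * t) * hexp

theorem linearSolution_affine (L c m t : ℝ) :
    linearSolution L c (fun s => m + L * (c + m * s)) t = c + m * t := by
  simpa [linearSolution] using
    linearSolution_add_affine (L := L) (x := 0) c m (intervalIntegrable_const (c := (0 : ℝ)))

theorem linearSolution_const (L c t : ℝ) : linearSolution L c (fun _ => L * c) t = c := by
  simpa using linearSolution_affine L c 0 t

theorem linearSolution_add_const (hG : IntervalIntegrable G volume 0 t) (L x c : ℝ) :
    linearSolution L (x + c) (fun s => G s + L * c) t = linearSolution L x G t + c := by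
  simpa using linearSolution_add_affine (L := L) (x := x) c 0 hG

theorem linearSolution_add (hG : ∀ p q, IntervalIntegrable G volume p q) (L x h t : ℝ) :
    linearSolution L x G (h + t)
      = linearSolution L (linearSolution L x G h) (fun s => G (h + s)) t := by
  have hsplit := intervalIntegral.integral_add_adjacent_intervals
    (intervalIntegrable_exp_mul L (hG 0 h)) (intervalIntegrable_exp_mul L (hG h (h + t)))
  have hshift : ∫ s in h..h + t, exp (L * s) * G s
      = exp (L * h) * ∫ s in (0 : ℝ)..t, exp (L * s) * G (h + s) := by
    rw [← intervalIntegral.integral_const_mul]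
    conv_lhs => rw [← add_zero h, add_assoc, zero_add]
    rw [← intervalIntegral.integral_comp_add_left]
    congr 1 with s
    rw [mul_add, exp_add, mul_assoc]
  have hexp : exp (-(L * h)) * exp (L * h) = 1 := by rw [← exp_add]; simp
  rw [linearSolution, ← hsplit, hshift]
  simp only [linearSolution, mul_add, neg_add, exp_add]
  linear_combination
    exp (-(L * t)) * (∫ s in (0 : ℝ)..t, exp (L * s) * G (h + s)) * hexp

theorem continuous_linearSolution (hG : ∀ p q, IntervalIntegrable G volume p q) (L x : ℝ) :
    Continuous (linearSolution L x G) := by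
  have := intervalIntegral.continuous_primitive (fun p q => intervalIntegrable_exp_mul L (hG p q)) 0
  unfold linearSolution
  fun_prop

theorem hasDerivAt_linearSolution (hG : Continuous G) (L x t : ℝ) :
    HasDerivAt (linearSolution L x G) (-L * linearSolution L x G t + G t) t := by
  have hexp : HasDerivAt (fun t => exp (-(L * t))) (exp (-(L * t)) * (-L)) t := by
    simpa using ((hasDerivAt_id t).const_mul L).neg.exp
  have hcont : Continuous fun s => exp (L * s) * G s := by fun_prop
  refine (hexp.mul ((hcont.integral_hasStrictDerivAt 0 t).hasDerivAt.const_add x)).congr_deriv ?_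
  have hcancel : exp (-(L * t)) * exp (L * t) = 1 := by rw [← exp_add]; simp
  unfold linearSolution
  linear_combination G t * hcancel

theorem eq_zero_of_tendsto_deriv {φ φ' : ℝ → ℝ} {l c : ℝ}
    (hd : ∀ t, 0 ≤ t → HasDerivWithinAt φ (φ' t) (Ici 0) t) (hφ : Tendsto φ atTop (𝓝 l))
    (hφ' : Tendsto φ' atTop (𝓝 c)) : c = 0 := by
  have hmvt (n : ℕ) : ∃ ξ : ℝ, (n : ℝ) ≤ ξ ∧ φ' ξ = φ (n + 1) - φ n := by
    have hn : (0 : ℝ) ≤ n := n.cast_nonneg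
    obtain ⟨ξ, hξ, h⟩ := exists_hasDerivAt_eq_slope φ φ' (lt_add_one (n : ℝ))
      (fun t ht => ((hd t (hn.trans ht.1)).continuousWithinAt).mono fun s hs => hn.trans hs.1)
      (fun t ht => (hd t (hn.trans ht.1.le)).hasDerivAt (Ici_mem_nhds (hn.trans_lt ht.1)))
    exact ⟨ξ, hξ.1.le, by rw [h]; simp⟩
  choose ξ hξ hξ' using hmvt
  have hderiv : Tendsto (fun n => φ' (ξ n)) atTop (𝓝 c) :=
    hφ'.comp (tendsto_atTop_mono hξ tendsto_natCast_atTop_atTop)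
  have hdiff : Tendsto (fun n : ℕ => φ (n + 1) - φ n) atTop (𝓝 (l - l)) :=
    (hφ.comp (tendsto_atTop_add_const_right _ 1 tendsto_natCast_atTop_atTop)).sub
      (hφ.comp tendsto_natCast_atTop_atTop)
  simp only [hξ'] at hderiv
  rw [sub_self] at hdiff
  exact tendsto_nhds_unique hderiv hdiff

end LinearEquation

section Cooperative

variable {V : Type*}

/-- `f` is continuous and, up to the linear term `L u`, monotone (that is, cooperative) on the order
interval `[a, b]`, where `a` is a subsolution and `b` a supersolution of `u' = f u`. -/
structure IsCooperativeOn (f : (V → ℝ) → V → ℝ) (a b L : V → ℝ) : Prop where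
  continuousOn : ∀ i, ContinuousOn (fun u => f u i) (Icc a b)
  mono : ∀ i, ∀ u ∈ Icc a b, ∀ v ∈ Icc a b, u ≤ v → f u i + L i * u i ≤ f v i + L i * v i
  sub : ∀ i, 0 ≤ f a i
  super : ∀ i, f b i ≤ 0

variable {f : (V → ℝ) → V → ℝ} {a b L : V → ℝ}

/-- The inhomogeneity `G` when `u' = f u` is written as `u' = -L u + G`. -/
def forcing (f : (V → ℝ) → V → ℝ) (L : V → ℝ) (u : ℝ → Icc a b) (i : V) (t : ℝ) : ℝ :=
  f (u t) i + L i * (u t : V → ℝ) i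

namespace IsCooperativeOn

variable (hf : IsCooperativeOn f a b L)

include hf

theorem forcing_mono {u v : ℝ → Icc a b} {s t : ℝ} (h : u s ≤ v t) (i : V) :
    forcing f L u i s ≤ forcing f L v i t :=
  hf.mono i _ (u s).2 _ (v t).2 h

theorem intervalIntegrable_forcing (u : ℝ →o Icc a b) (i : V) (p q : ℝ) :
    IntervalIntegrable (forcing f L u i) MeasureTheory.volume p q :=
  Monotone.intervalIntegrable fun _ _ hst => hf.forcing_mono (u.mono hst) i

theorem mul_le_forcing (u : ℝ → Icc a b) (i : V) (t : ℝ) : L i * a i ≤ forcing f L u i t := by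
  have hab := (u t).2.1.trans (u t).2.2
  exact (le_add_of_nonneg_left (hf.sub i)).trans
    (hf.mono i a ⟨le_rfl, hab⟩ _ (u t).2 (u t).2.1)

theorem forcing_le_mul (u : ℝ → Icc a b) (i : V) (t : ℝ) : forcing f L u i t ≤ L i * b i := by
  have hab := (u t).2.1.trans (u t).2.2
  exact (hf.mono i _ (u t).2 b ⟨hab, le_rfl⟩ (u t).2.2).trans
    (add_le_of_nonpos_left (hf.super i))

theorem le_linearSolution (u : ℝ →o Icc a b) (i : V) {t : ℝ} (ht : 0 ≤ t) :
    a i ≤ linearSolution (L i) (a i) (forcing f L u i) t := by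
  calc a i = linearSolution (L i) (a i) (fun _ => L i * a i) t := (linearSolution_const ..).symm
    _ ≤ _ := linearSolution_mono le_rfl ht intervalIntegrable_const
      (hf.intervalIntegrable_forcing u i 0 t) fun s _ => hf.mul_le_forcing u i s

theorem linearSolution_le (u : ℝ →o Icc a b) (i : V) {t : ℝ} (ht : 0 ≤ t) :
    linearSolution (L i) (a i) (forcing f L u i) t ≤ b i := by
  have hab := (u t).2.1.trans (u t).2.2
  calc linearSolution (L i) (a i) (forcing f L u i) t
      ≤ linearSolution (L i) (b i) (fun _ => L i * b i) t :=
        linearSolution_mono (hab i) ht (hf.intervalIntegrable_forcing u i 0 t)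
          intervalIntegrable_const fun s _ => hf.forcing_le_mul u i s
    _ = b i := linearSolution_const ..

theorem linearSolution_monotoneOn (u : ℝ →o Icc a b) (i : V) :
    MonotoneOn (linearSolution (L i) (a i) (forcing f L u i)) (Ici 0) := by
  intro s hs t _ hst
  have hG := hf.intervalIntegrable_forcing u i
  have hts : 0 ≤ t - s := sub_nonneg.2 hst
  calc linearSolution (L i) (a i) (forcing f L u i) s
      ≤ linearSolution (L i) (linearSolution (L i) (a i) (forcing f L u i) (t - s))
          (fun r => forcing f L u i (t - s + r)) s :=
        linearSolution_mono (hf.le_linearSolution u i hts) hs (hG 0 s)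
          (Monotone.intervalIntegrable fun _ _ h => hf.forcing_mono (u.mono (by gcongr)) i)
          fun r _ => hf.forcing_mono (u.mono (by linarith)) i
    _ = linearSolution (L i) (a i) (forcing f L u i) (t - s + s) :=
        (linearSolution_add hG ..).symm
    _ = linearSolution (L i) (a i) (forcing f L u i) t := by rw [sub_add_cancel]

omit hf in
/-- The Picard operator of `u' = -L u + G`, `u 0 = a`, on the nondecreasing curves in `[a, b]`. The
curves are parametrized by `ℝ` and made constant at negative times. -/
def picard (hf : IsCooperativeOn f a b L) : (ℝ →o Icc a b) →o (ℝ →o Icc a b) where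
  toFun u :=
    { toFun := fun t => ⟨fun i => linearSolution (L i) (a i) (forcing f L u i) (max t 0),
        fun i => hf.le_linearSolution u i (le_max_right t 0),
        fun i => hf.linearSolution_le u i (le_max_right t 0)⟩
      monotone' := fun s t hst i => hf.linearSolution_monotoneOn u i (le_max_right s 0)
        (le_max_right t 0) (max_le_max_right 0 hst) }
  monotone' u v huv t i := linearSolution_mono le_rfl (le_max_right t 0)
    (hf.intervalIntegrable_forcing u i _ _) (hf.intervalIntegrable_forcing v i _ _)
    fun s _ => hf.forcing_mono (huv s) i

variable [Fact (a ≤ b)]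

omit hf in
/-- The minimal solution of `u' = f u`, `u 0 = a`, in `[a, b]`, as the least fixed point (after
Knaster and Tarski) of the Picard operator. -/
def minimalSolution (hf : IsCooperativeOn f a b L) : ℝ →o Icc a b := hf.picard.lfp

theorem picard_minimalSolution : hf.picard hf.minimalSolution = hf.minimalSolution :=
  OrderHom.map_lfp (α := ℝ →o Icc a b) hf.picard

theorem minimalSolution_apply (t : ℝ) (i : V) :
    (hf.minimalSolution t : V → ℝ) i
      = linearSolution (L i) (a i) (forcing f L hf.minimalSolution i) (max t 0) :=
  congrArg (fun u : ℝ →o Icc a b => (u t : V → ℝ) i) hf.picard_minimalSolution.symm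

theorem minimalSolution_induction {p : (ℝ →o Icc a b) → Prop}
    (hstep : ∀ u, p u → u ≤ hf.minimalSolution → p (hf.picard u))
    (hsup : ∀ S, (∀ u ∈ S, p u) → p (sSup S)) : p hf.minimalSolution :=
  @OrderHom.lfp_induction (ℝ →o Icc a b) inferInstance hf.picard p hstep hsup

theorem minimalSolution_zero : (hf.minimalSolution 0 : V → ℝ) = a :=
  funext fun i => by rw [hf.minimalSolution_apply, max_self, linearSolution_zero]

theorem continuous_minimalSolution : Continuous fun t => (hf.minimalSolution t : V → ℝ) := by
  refine continuous_pi fun i => ?_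
  simp only [hf.minimalSolution_apply]
  exact (continuous_linearSolution (hf.intervalIntegrable_forcing _ i) _ _).comp (by fun_prop)

theorem hasDerivWithinAt_minimalSolution {t : ℝ} (ht : 0 ≤ t) (i : V) :
    HasDerivWithinAt (fun s => (hf.minimalSolution s : V → ℝ) i) (f (hf.minimalSolution t) i)
      (Ici 0) t := by
  have hcont : Continuous (forcing f L hf.minimalSolution i) :=
    ((hf.continuousOn i).comp_continuous hf.continuous_minimalSolution fun t =>
      (hf.minimalSolution t).2).add
      (continuous_const.mul ((continuous_apply i).comp hf.continuous_minimalSolution))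
  have heq (s : ℝ) (hs : 0 ≤ s) : (hf.minimalSolution s : V → ℝ) i
      = linearSolution (L i) (a i) (forcing f L hf.minimalSolution i) s := by
    rw [hf.minimalSolution_apply, max_eq_left hs]
  refine ((hasDerivAt_linearSolution hcont (L i) (a i) t).hasDerivWithinAt.congr heq
    (heq t ht)).congr_deriv ?_
  rw [← heq t ht, forcing]
  ring

theorem exists_tendsto_minimalSolution :
    ∃ c ∈ Icc a b, (∀ i, Tendsto (fun t => (hf.minimalSolution t : V → ℝ) i) atTop (𝓝 (c i))) ∧
      ∀ i, f c i = 0 := by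
  set c : V → ℝ := fun i => ⨆ t, (hf.minimalSolution t : V → ℝ) i
  have hlim (i : V) : Tendsto (fun t => (hf.minimalSolution t : V → ℝ) i) atTop (𝓝 (c i)) :=
    tendsto_atTop_ciSup (fun _ _ hst => hf.minimalSolution.mono hst i)
      ⟨b i, forall_mem_range.2 fun t => (hf.minimalSolution t).2.2 i⟩
  have hlim' : Tendsto (fun t => (hf.minimalSolution t : V → ℝ)) atTop (𝓝[Icc a b] c) :=
    tendsto_nhdsWithin_iff.2
      ⟨tendsto_pi_nhds.2 hlim, Eventually.of_forall fun t => (hf.minimalSolution t).2⟩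
  have hc : c ∈ Icc a b := isClosed_Icc.mem_of_tendsto (hlim'.mono_right nhdsWithin_le_nhds)
    (Eventually.of_forall fun t => (hf.minimalSolution t).2)
  exact ⟨c, hc, hlim, fun i => eq_zero_of_tendsto_deriv
    (fun t ht => hf.hasDerivWithinAt_minimalSolution ht i) (hlim i)
    ((hf.continuousOn i c hc).tendsto.comp hlim')⟩

variable {M : ℝ} (hM : 0 ≤ M) (ha : ∀ i, f a i ≤ M)
  (hadd : ∀ i, ∀ u ∈ Icc a b, ∀ v ∈ Icc a b, ∀ m, 0 ≤ m → (∀ j, v j - u j ≤ m) →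
    f v i + L i * v i ≤ f u i + L i * u i + L i * m)

include hM ha hadd

omit [Fact (a ≤ b)] in
theorem linearSolution_le_add_mul {u : ℝ →o Icc a b} {h : ℝ} (hh : 0 ≤ h)
    (hu : ∀ s, 0 ≤ s → ∀ j, (u s : V → ℝ) j ≤ a j + M * s) (i : V) :
    linearSolution (L i) (a i) (forcing f L u i) h ≤ a i + M * h := by
  have hforcing (s : ℝ) (hs : 0 ≤ s) : forcing f L u i s ≤ M + L i * (a i + M * s) := by
    have hab := (u s).2.1.trans (u s).2.2
    have := hadd i a ⟨le_rfl, hab⟩ _ (u s).2 (M * s) (mul_nonneg hM hs)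
      fun j => sub_le_iff_le_add'.2 (hu s hs j)
    rw [forcing]
    linarith [ha i]
  calc linearSolution (L i) (a i) (forcing f L u i) h
      ≤ linearSolution (L i) (a i) (fun s => M + L i * (a i + M * s)) h :=
        linearSolution_mono le_rfl hh (hf.intervalIntegrable_forcing u i 0 h)
          (Continuous.intervalIntegrable (by fun_prop) _ _) fun s hs => hforcing s hs.1
    _ = a i + M * h := linearSolution_affine ..

omit [Fact (a ≤ b)] in
theorem picard_add_le {u : ℝ →o Icc a b} (hu₀ : (u 0 : V → ℝ) ≤ a)
    (hu : ∀ t h, 0 ≤ t → 0 ≤ h → ∀ i, (u (t + h) : V → ℝ) i ≤ (u t : V → ℝ) i + M * h)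
    {t h : ℝ} (ht : 0 ≤ t) (hh : 0 ≤ h) (i : V) :
    (hf.picard u (t + h) : V → ℝ) i ≤ (hf.picard u t : V → ℝ) i + M * h := by
  have hstart := hf.linearSolution_le_add_mul hM ha hadd hh
    (fun s hs j => by simpa using (hu 0 s le_rfl hs j).trans (by gcongr; exact hu₀ j)) i
  have hforcing (s : ℝ) (hs : 0 ≤ s) :
      forcing f L u i (h + s) ≤ forcing f L u i s + L i * (M * h) :=
    hadd i _ (u s).2 _ (u (h + s)).2 (M * h) (mul_nonneg hM hh) fun j => by
      rw [add_comm h s]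
      exact sub_le_iff_le_add'.2 (hu s h hs hh j)
  have hG := hf.intervalIntegrable_forcing u i
  change linearSolution _ _ _ (max (t + h) 0) ≤ linearSolution _ _ _ (max t 0) + M * h
  rw [max_eq_left ht, max_eq_left (add_nonneg ht hh), add_comm t h, linearSolution_add hG]
  calc linearSolution (L i) (linearSolution (L i) (a i) (forcing f L u i) h)
        (fun s => forcing f L u i (h + s)) t
      ≤ linearSolution (L i) (a i + M * h) (fun s => forcing f L u i s + L i * (M * h)) t :=
        linearSolution_mono hstart ht
          (Monotone.intervalIntegrable fun _ _ hst => hf.forcing_mono (u.mono (by gcongr)) i)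
          ((hG 0 t).add intervalIntegrable_const) fun s hs => hforcing s hs.1
    _ = linearSolution (L i) (a i) (forcing f L u i) t + M * h :=
      linearSolution_add_const (hG 0 t) ..

theorem minimalSolution_add_le {t h : ℝ} (ht : 0 ≤ t) (hh : 0 ≤ h) (i : V) :
    (hf.minimalSolution (t + h) : V → ℝ) i ≤ (hf.minimalSolution t : V → ℝ) i + M * h := by
  refine hf.minimalSolution_induction (p := fun u => ∀ t h, 0 ≤ t → 0 ≤ h →
    ∀ i, (u (t + h) : V → ℝ) i ≤ (u t : V → ℝ) i + M * h) (fun u hu hle t h ht hh i => ?_)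
    (fun S hS t h ht hh i => ?_) t h ht hh i
  · exact hf.picard_add_le hM ha hadd
      (fun j => (hle 0 j).trans_eq (congrFun hf.minimalSolution_zero j)) hu ht hh i
  · set c : V → ℝ := b ⊓ fun i => (sSup S t : V → ℝ) i + M * h
    have hc : c ∈ Icc a b := ⟨le_inf Fact.out fun i =>
      ((sSup S t).2.1 i).trans (le_add_of_nonneg_right (mul_nonneg hM hh)), inf_le_left⟩
    suffices hsup : sSup S (t + h) ≤ ⟨c, hc⟩ from (hsup i).trans (inf_le_right (α := ℝ))
    rw [OrderHom.sSup_apply]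
    refine iSup₂_le fun u hu => le_inf (u (t + h)).2.2 fun i => (hS u hu t h ht hh i).trans ?_
    gcongr
    exact le_sSup hu t i

theorem velocity_minimalSolution_le {t : ℝ} (ht : 0 ≤ t) (i : V) :
    f (hf.minimalSolution t) i ≤ M := by
  have hanti : AntitoneOn (fun s => (hf.minimalSolution s : V → ℝ) i - M * s) (Ici 0) := by
    intro s hs r _ hsr
    have := hf.minimalSolution_add_le hM ha hadd hs (sub_nonneg.2 hsr) i
    rw [add_sub_cancel] at this
    linarith
  have hderiv := (hf.hasDerivWithinAt_minimalSolution ht i).sub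
    ((hasDerivWithinAt_id t (Ici 0)).const_mul M)
  have := hderiv.derivWithin (uniqueDiffOn_Ici 0 t ht) ▸ hanti.derivWithin_nonpos
  linarith

end IsCooperativeOn

end Cooperative

section Flow

variable {V : Type*} {T : AbstractSimplicialComplex V} {Φ : Sym2 V → ℝ} {Khat u₀ : V → ℝ}
  (hT : ∀ v : V, {σ : Finset V | σ ∈ T ∧ v ∈ σ}.Finite) (hΦ : ∀ e ∈ edges T, 0 ≤ cos (Φ e))

section Existence

include hT hΦ

theorem isCooperativeOn_sub_K {b : V → ℝ} (hb : IsConformalFactor b)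
    (hsub : ∀ i, K T Φ u₀ i ≤ Khat i) (hsuper : ∀ i, Khat i ≤ K T Φ b i) :
    IsCooperativeOn (fun u i => Khat i - K T Φ u i) u₀ b
      (fun i => 12 * (oppositeSides T i).ncard) where
  continuousOn i := continuousOn_const.sub
    ((continuousOn_K hT hΦ i).mono fun _ hu j => (hu.2 j).trans_lt (hb j))
  mono i u hu v hv huv := by
    linarith [K_sub_mul_anti hT hΦ i (fun j => (hu.2 j).trans_lt (hb j))
      (fun j => (hv.2 j).trans_lt (hb j)) huv]
  sub i := sub_nonneg.2 (hsub i)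
  super i := sub_nonpos.2 (hsuper i)

theorem exists_flowSolution (hKhat : ∀ i, Khat i < 2 * π) (hu₀ : IsConformalFactor u₀)
    (hle : ∀ i, K T Φ u₀ i ≤ Khat i) :
    ∃ u : ℝ → V → ℝ, IsFlowSolution T Φ Khat u ∧ u 0 = u₀ ∧
      (∃ uLim : V → ℝ, IsConformalFactor uLim ∧
        (∀ i, Tendsto (fun t => u t i) atTop (𝓝 (uLim i))) ∧ ∀ i, K T Φ uLim i = Khat i) ∧
      ∀ M, 0 ≤ M → (∀ i, Khat i - K T Φ u₀ i ≤ M) →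
        ∀ t, 0 ≤ t → ∀ i, Khat i - K T Φ (u t) i ≤ M := by
  choose b hab hb hbK using fun i => exists_le_K hT hΦ i (hKhat i) (hu₀ i)
  have hbox {u : V → ℝ} (hu : u ∈ Icc u₀ b) : IsConformalFactor u := fun i =>
    (hu.2 i).trans_lt (hb i)
  have hf := isCooperativeOn_sub_K hT hΦ hb hle fun i => hbK i b hb rfl
  have : Fact (u₀ ≤ b) := ⟨hab⟩
  obtain ⟨c, hc, hlim, hKc⟩ := hf.exists_tendsto_minimalSolution
  refine ⟨fun t => hf.minimalSolution t, ⟨fun t _ => hbox (hf.minimalSolution t).2,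
    fun t ht i => (hf.hasDerivWithinAt_minimalSolution ht i).congr_deriv (by ring)⟩,
    hf.minimalSolution_zero, ⟨c, hbox hc, hlim, fun i => (sub_eq_zero.1 (hKc i)).symm⟩,
    fun M hM hvelocity t ht i => hf.velocity_minimalSolution_le hM hvelocity ?_ ht i⟩
  intro i u hu v hv m hm huv
  linarith [K_sub_mul_le hT hΦ i (hbox hu) (hbox hv) hm huv]

end Existence

section Solutions

variable {u v : ℝ → V → ℝ} (hu : IsFlowSolution T Φ Khat u) (hv : IsFlowSolution T Φ Khat v)

include hu hv in
theorem IsFlowSolution.hasDerivWithinAt_sub {t : ℝ} (ht : 0 ≤ t) (i : V) :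
    HasDerivWithinAt (fun s => u s i - v s i) (K T Φ (v t) i - K T Φ (u t) i) (Ici 0) t :=
  ((hu.flow t ht i).sub (hv.flow t ht i)).congr_deriv (by ring)

include hu hv in
theorem IsFlowSolution.abs_sub_le (h₀ : u 0 = v 0) {C t : ℝ}
    (hCu : ∀ t, 0 ≤ t → ∀ i, |K T Φ (u t) i| ≤ C) (hCv : ∀ t, 0 ≤ t → ∀ i, |K T Φ (v t) i| ≤ C)
    (ht : 0 ≤ t) (i : V) : |u t i - v t i| ≤ 2 * C * t := by
  have hmvt := (convex_Ici (0 : ℝ)).norm_image_sub_le_of_norm_hasDerivWithin_le (C := 2 * C)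
    (fun s hs => hu.hasDerivWithinAt_sub hv hs i)
    (fun s hs => (abs_sub _ _).trans (by linarith [hCu s hs i, hCv s hs i]))
    self_mem_Ici (mem_Ici.2 ht)
  simpa [h₀, abs_of_nonneg ht] using hmvt

include hT hΦ

theorem K_sub_K_le {u v : V → ℝ} (hu : IsConformalFactor u) (hv : IsConformalFactor v)
    {C m m₀ : ℝ} {i : V} (hC : |K T Φ v i| ≤ C) (hm : 0 ≤ m) (hm₀ : m ≤ m₀) (hi : v i ≤ u i)
    (hle : ∀ j, u j - v j ≤ m) :
    K T Φ v i - K T Φ u i ≤ 6 * (2 * π + C) * exp (6 * m₀) * m := by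
  have hharnack := two_pi_sub_K_le hT hΦ i hv hu hm hi hle
  have hexp : exp (6 * m) - 1 ≤ 6 * m * exp (6 * m₀) := by
    have hcancel : exp (6 * m) * exp (-(6 * m)) = 1 := by rw [← exp_add]; simp
    have htangent := mul_le_mul_of_nonneg_left (add_one_le_exp (-(6 * m))) (exp_pos (6 * m)).le
    calc exp (6 * m) - 1 ≤ 6 * m * exp (6 * m) := by linarith
      _ ≤ 6 * m * exp (6 * m₀) := by gcongr
  have hcurv : 2 * π - K T Φ v i ≤ 2 * π + C := by linarith [neg_abs_le (K T Φ v i)]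
  have hC₀ : 0 ≤ C := (abs_nonneg _).trans hC
  calc K T Φ v i - K T Φ u i ≤ (2 * π - K T Φ v i) * (exp (6 * m) - 1) := by linarith
    _ ≤ (2 * π + C) * (6 * m * exp (6 * m₀)) :=
      mul_le_mul hcurv hexp (sub_nonneg.2 (one_le_exp (by positivity))) (by positivity)
    _ = 6 * (2 * π + C) * exp (6 * m₀) * m := by ring

include hu

theorem IsFlowSolution.contDiffOn (n : ℕ) (i : V) :
    ContDiffOn ℝ n (fun t => u t i) (Ici 0) := by
  induction n generalizing i with
  | zero => exact contDiffOn_zero.2 fun t ht => (hu.flow t ht i).continuousWithinAt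
  | succ n ih =>
    push_cast
    refine (contDiffOn_succ_iff_derivWithin (uniqueDiffOn_Ici 0)).2
      ⟨fun t ht => (hu.flow t ht i).differentiableWithinAt, by simp, ?_⟩
    exact ((contDiffOn_K hT hΦ i hu.conformal ih).sub contDiffOn_const).neg.congr
      fun t ht => (hu.flow t ht i).derivWithin (uniqueDiffOn_Ici 0 t ht)

theorem IsFlowSolution.isSmoothInTime : IsSmoothInTime u :=
  fun i => contDiffOn_infty.2 fun n => hu.contDiffOn hT hΦ n i

theorem IsFlowSolution.isSmoothInTime_K : IsSmoothInTime fun t => K T Φ (u t) :=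
  fun i => contDiffOn_K hT hΦ i hu.conformal (hu.isSmoothInTime hT hΦ)

theorem IsFlowSolution.hasBoundedCurvature {B C : ℝ} (hKhat : ∀ i, C ≤ Khat i)
    (hB : ∀ t, 0 ≤ t → ∀ i, Khat i - K T Φ (u t) i ≤ B) : HasBoundedCurvature T Φ u :=
  ⟨max (2 * π) (B - C), fun t ht i => abs_le'.2
    ⟨le_max_of_le_left (K_le_two_pi hT hΦ i (hu.conformal t ht)),
      le_max_of_le_right (by linarith [hKhat i, hB t ht i])⟩⟩

include hv

-- At a first contact with the new barrier, the difference grows at most at the rate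
-- `Λ * (M * exp (4 * Λ * s))`, half of the slope of the barrier.
theorem IsFlowSolution.sub_le_half (h₀ : u 0 = v 0) {C m₀ M t₀ Λ : ℝ}
    (hC : ∀ t, 0 ≤ t → ∀ i, |K T Φ (v t) i| ≤ C) (hM : 0 < M) (hm₀ : 0 ≤ m₀) (hΛ : 0 < Λ)
    (hCΛ : 6 * (2 * π + C) * exp (6 * m₀) ≤ Λ)
    (hbd : ∀ t ∈ Icc 0 t₀, ∀ i, u t i - v t i ≤ m₀)
    (hle : ∀ t ∈ Icc 0 t₀, ∀ i, u t i - v t i ≤ M * exp (4 * Λ * t)) :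
    ∀ t ∈ Icc 0 t₀, ∀ i, u t i - v t i ≤ M / 2 * exp (4 * Λ * t) := by
  intro t ht i
  have hbarrier (s : ℝ) : HasDerivAt (fun s => M / 2 * exp (4 * Λ * s))
      (M / 2 * (exp (4 * Λ * s) * (4 * Λ))) s := by
    simpa using (((hasDerivAt_id s).const_mul (4 * Λ)).exp).const_mul (M / 2)
  refine image_le_of_deriv_right_lt_deriv_boundary (a := 0) (b := t₀)
    (fun s hs => (hu.hasDerivWithinAt_sub hv hs.1 i).continuousWithinAt.mono fun r hr => hr.1)
    (fun s hs => (hu.hasDerivWithinAt_sub hv hs.1 i).mono fun r hr => hs.1.trans hr)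
    (by simp only [h₀, sub_self]; positivity) hbarrier (fun s hs hcontact => ?_) ht
  have hsI : s ∈ Icc 0 t₀ := ⟨hs.1, hs.2.le⟩
  have hpos : 0 < M * exp (4 * Λ * s) := by positivity
  have hvelocity := K_sub_K_le hT hΦ (hu.conformal s hs.1) (hv.conformal s hs.1) (hC s hs.1 i)
    (le_min hm₀ hpos.le) (min_le_left m₀ (M * exp (4 * Λ * s))) (by linarith)
    fun j => le_min (hbd s hsI j) (hle s hsI j)
  calc K T Φ (v s) i - K T Φ (u s) i ≤ Λ * (M * exp (4 * Λ * s)) :=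
      hvelocity.trans (mul_le_mul hCΛ (min_le_right _ _) (le_min hm₀ hpos.le) hΛ.le)
    _ < M / 2 * (exp (4 * Λ * s) * (4 * Λ)) := by linarith [mul_pos hΛ hpos]

theorem IsFlowSolution.abs_sub_le_half_pow (h₀ : u 0 = v 0) {C m₀ t₀ Λ : ℝ}
    (hCu : ∀ t, 0 ≤ t → ∀ i, |K T Φ (u t) i| ≤ C) (hCv : ∀ t, 0 ≤ t → ∀ i, |K T Φ (v t) i| ≤ C)
    (hm₀ : 0 < m₀) (hΛ : 0 < Λ) (hCΛ : 6 * (2 * π + C) * exp (6 * m₀) ≤ Λ)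
    (hbd : ∀ t ∈ Icc 0 t₀, ∀ i, |u t i - v t i| ≤ m₀) (n : ℕ) :
    ∀ t ∈ Icc 0 t₀, ∀ i, |u t i - v t i| ≤ m₀ / 2 ^ n * exp (4 * Λ * t) := by
  induction n with
  | zero =>
    intro t ht i
    rw [pow_zero, div_one]
    exact (hbd t ht i).trans
      (le_mul_of_one_le_right hm₀.le (one_le_exp (mul_nonneg (by positivity) ht.1)))
  | succ n ih =>
    intro t ht i
    have hM : 0 < m₀ / 2 ^ n := by positivity
    rw [pow_succ, ← div_div]
    refine abs_sub_le_iff.2 ⟨?_, ?_⟩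
    · exact hu.sub_le_half hT hΦ hv h₀ hCv hM hm₀.le hΛ hCΛ
        (fun t ht i => (abs_sub_le_iff.1 (hbd t ht i)).1)
        (fun t ht i => (abs_sub_le_iff.1 (ih t ht i)).1) t ht i
    · exact hv.sub_le_half hT hΦ hu h₀.symm hCu hM hm₀.le hΛ hCΛ
        (fun t ht i => (abs_sub_le_iff.1 (hbd t ht i)).2)
        (fun t ht i => (abs_sub_le_iff.1 (ih t ht i)).2) t ht i

theorem IsFlowSolution.eq_of_hasBoundedCurvature (h₀ : u 0 = v 0)
    (hbu : HasBoundedCurvature T Φ u) (hbv : HasBoundedCurvature T Φ v) {t : ℝ} (ht : 0 ≤ t) :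
    u t = v t := by
  obtain ⟨C₁, hC₁⟩ := hbu
  obtain ⟨C₂, hC₂⟩ := hbv
  set C := max 0 (max C₁ C₂)
  have : 0 ≤ C := le_max_left _ _
  have hCu (s : ℝ) (hs : 0 ≤ s) (i : V) : |K T Φ (u s) i| ≤ C := by simp [C, hC₁ s hs i]
  have hCv (s : ℝ) (hs : 0 ≤ s) (i : V) : |K T Φ (v s) i| ≤ C := by simp [C, hC₂ s hs i]
  have hbd : ∀ s ∈ Icc 0 t, ∀ i, |u s i - v s i| ≤ 2 * C * t + 1 := fun s hs i =>
    calc |u s i - v s i| ≤ 2 * C * s := hu.abs_sub_le hv h₀ hCu hCv hs.1 i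
      _ ≤ 2 * C * t := by gcongr; exact hs.2
      _ ≤ 2 * C * t + 1 := le_add_of_nonneg_right zero_le_one
  have hhalf := hu.abs_sub_le_half_pow hT hΦ hv h₀ hCu hCv (by positivity) (by positivity) le_rfl
    hbd
  funext i
  have hlim := ((tendsto_const_nhds (x := 2 * C * t + 1)).div_atTop
    (tendsto_pow_atTop_atTop_of_one_lt (one_lt_two (α := ℝ)))).mul_const
      (exp (4 * (6 * (2 * π + C) * exp (6 * (2 * C * t + 1))) * t))
  have hzero := ge_of_tendsto' hlim fun n => hhalf n t ⟨ht, le_rfl⟩ i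
  rw [zero_mul] at hzero
  exact sub_eq_zero.1 (abs_nonpos_iff.1 hzero)

end Solutions

end Flow

end CirclePacking

end

theorem theorem4p2_general {V : Type*} (T : AbstractSimplicialComplex V)
    (hT : ∀ v : V, {σ : Finset V | σ ∈ T ∧ v ∈ σ}.Finite)
    (Φ : Sym2 V → ℝ) (hΦ : ∀ e ∈ CirclePacking.edges T, 0 ≤ Real.cos (Φ e))
    (Khat : V → ℝ) (hKhat : ∀ i, Khat i < 2 * Real.pi)
    (u₀ : V → ℝ) (hu₀ : CirclePacking.IsConformalFactor u₀)
    (hle : ∀ i, CirclePacking.K T Φ u₀ i ≤ Khat i) :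
    (∃ u : ℝ → V → ℝ, CirclePacking.IsFlowSolution T Φ Khat u ∧ u 0 = u₀ ∧
      ∃ uLim : V → ℝ, CirclePacking.IsConformalFactor uLim ∧
        (∀ i, Filter.Tendsto (fun t => u t i) Filter.atTop (nhds (uLim i))) ∧
        ∀ i, CirclePacking.K T Φ uLim i = Khat i) ∧
    ((∃ C : ℝ, ∀ i, |CirclePacking.K T Φ u₀ i| ≤ C) →
      ∃ u : ℝ → V → ℝ,
        (CirclePacking.IsFlowSolution T Φ Khat u ∧ u 0 = u₀ ∧
          CirclePacking.IsSmoothInTime u ∧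
          CirclePacking.IsSmoothInTime (fun t => CirclePacking.K T Φ (u t)) ∧
          CirclePacking.HasBoundedCurvature T Φ u) ∧
        ∀ v : ℝ → V → ℝ,
          CirclePacking.IsFlowSolution T Φ Khat v → v 0 = u₀ →
          CirclePacking.HasBoundedCurvature T Φ v →
          ∀ t, 0 ≤ t → v t = u t) := by
  obtain ⟨u, hu, hu_zero, hlim, hvelocity⟩ :=
    CirclePacking.exists_flowSolution hT hΦ hKhat hu₀ hle
  refine ⟨⟨u, hu, hu_zero, hlim⟩, fun ⟨C, hC⟩ => ?_⟩
  have hlower (i : V) : -C ≤ CirclePacking.K T Φ u₀ i := (abs_le.1 (hC i)).1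
  have hbound : CirclePacking.HasBoundedCurvature T Φ u :=
    hu.hasBoundedCurvature hT hΦ (fun i => (hlower i).trans (hle i)) <|
      hvelocity (max 0 (2 * Real.pi + C)) (le_max_left _ _) fun i =>
        le_max_of_le_right (by linarith [hKhat i, hlower i])
  exact ⟨u, ⟨hu, hu_zero, hu.isSmoothInTime hT hΦ, hu.isSmoothInTime_K hT hΦ, hbound⟩,
    fun v hv hv_zero hbv t ht =>
      hv.eq_of_hasBoundedCurvature hT hΦ hu (hv_zero.trans hu_zero.symm) hbv hbound ht⟩

theorem theorem4p2 {V : Type*} (T : AbstractSimplicialComplex V)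
    (hT : CirclePacking.IsInfiniteDiskTriangulation T)
    (Φ : Sym2 V → ℝ) (hΦ : ∀ e ∈ CirclePacking.edges T, Φ e ∈ Set.Icc 0 (Real.pi / 2))
    (Khat : V → ℝ) (hKhat : ∀ i, Khat i < 2 * Real.pi)
    (u₀ : V → ℝ) (hu₀ : CirclePacking.IsConformalFactor u₀)
    (hle : ∀ i, CirclePacking.K T Φ u₀ i ≤ Khat i) :
    (∃ u : ℝ → V → ℝ, CirclePacking.IsFlowSolution T Φ Khat u ∧ u 0 = u₀ ∧
      ∃ uLim : V → ℝ, CirclePacking.IsConformalFactor uLim ∧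
        (∀ i, Filter.Tendsto (fun t => u t i) Filter.atTop (nhds (uLim i))) ∧
        ∀ i, CirclePacking.K T Φ uLim i = Khat i) ∧
    ((∃ C : ℝ, ∀ i, |CirclePacking.K T Φ u₀ i| ≤ C) →
      ∃ u : ℝ → V → ℝ,
        (CirclePacking.IsFlowSolution T Φ Khat u ∧ u 0 = u₀ ∧
          CirclePacking.IsSmoothInTime u ∧
          CirclePacking.IsSmoothInTime (fun t => CirclePacking.K T Φ (u t)) ∧
          CirclePacking.HasBoundedCurvature T Φ u) ∧
        ∀ v : ℝ → V → ℝ,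
          CirclePacking.IsFlowSolution T Φ Khat v → v 0 = u₀ →
          CirclePacking.HasBoundedCurvature T Φ v →
          ∀ t, 0 ≤ t → v t = u t) :=
  theorem4p2_general T hT.locallyFinite Φ (fun e he => Real.cos_nonneg_of_neg_pi_div_two_le_of_le
    (by linarith [(hΦ e he).1, Real.pi_pos]) (hΦ e he).2) Khat hKhat u₀ hu₀ hle
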